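/- Let $M$ be a closed (compact, without boundary) connected smooth manifold of positive dimension and let $\omega$ be a symplectic form on $M$, i.e. a smooth closed non-degenerate $2$-form. Let $p:\widetilde M\to M$ be the universal covering. Suppose that $(M,\omega)$ is symplectically hyperbolic, which means that there are a smooth $1$-form $\alpha$ on $\widetilde M$ and a constant $C\in\mathbb R$ with $p^*\omega=d\alpha$ and $\sup_{x\in\widetilde M}|\alpha(x)|\le C$, where $|\alpha(x)|=\max\{\alpha(x)(X) : |X|=1\}$ and $|X|$ is measured in the metric $p^*g$ induced by a Riemannian metric $g$ on $M$ (by compactness of $M$ the condition does not depend on the choice of $g$). Then the fundamental group $\pi_1(M)$ is non-amenable, i.e. there is no left-invariant mean on the bounded real functions on the discrete group $\pi_1(M)$. -/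

import Mathlib

open scoped Manifold ContDiff

noncomputable section

namespace SymplecticHyperbolic

section Forms

variable (E : Type*) [NormedAddCommGroup E] [NormedSpace ℝ E]

/-- A (not necessarily smooth) real differential `k`-form on a manifold `M` modelled on `E`:
an alternating `k`-linear form on every tangent space. -/
abbrev DiffForm (M : Type*) [TopologicalSpace M] [ChartedSpace E M] (k : ℕ) : Type _ :=
  ∀ x : M, (TangentSpace 𝓘(ℝ, E) x) [⋀^Fin k]→L[ℝ] ℝ

variable {E}
variable {M : Type*} [TopologicalSpace M] [ChartedSpace E M]
variable {N : Type*} [TopologicalSpace N] [ChartedSpace E N] {k : ℕ}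

namespace DiffForm

/-- The expression of a form in the preferred chart around `x₀`, i.e. its pullback under the
inverse of the chart. It is meaningful on the (open) target of the chart. -/
def inChart (η : DiffForm E M k) (x₀ : M) (y : E) : E [⋀^Fin k]→L[ℝ] ℝ :=
  (η ((extChartAt 𝓘(ℝ, E) x₀).symm y)).compContinuousLinearMap
    (mfderiv 𝓘(ℝ, E) 𝓘(ℝ, E) (extChartAt 𝓘(ℝ, E) x₀).symm y)

/-- A form is smooth if all its expressions in charts are smooth. -/
def IsSmooth (η : DiffForm E M k) : Prop :=
  ∀ x₀ : M, ContDiffOn ℝ ∞ (η.inChart x₀) (extChartAt 𝓘(ℝ, E) x₀).target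

/-- The exterior derivative of a form: at `x` it is the exterior derivative of the expression of
the form in the preferred chart around `x`, pulled back to the tangent space at `x`. -/
def d (η : DiffForm E M k) : DiffForm E M (k + 1) := fun x =>
  (extDeriv (η.inChart x) (extChartAt 𝓘(ℝ, E) x x)).compContinuousLinearMap
    (mfderiv 𝓘(ℝ, E) 𝓘(ℝ, E) (extChartAt 𝓘(ℝ, E) x) x)

/-- The pullback `p^* η` of a form under a map `p`. -/
def pullback (p : N → M) (η : DiffForm E M k) : DiffForm E N k := fun x =>
  (η (p x)).compContinuousLinearMap (mfderiv 𝓘(ℝ, E) 𝓘(ℝ, E) p x)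

end DiffForm

/-- A symplectic form: a smooth closed non-degenerate `2`-form. -/
structure IsSymplectic (Ω : DiffForm E M 2) : Prop where
  smooth : Ω.IsSmooth
  closed : ∀ x, Ω.d x = 0
  nondegenerate : ∀ (x : M) (v : TangentSpace 𝓘(ℝ, E) x),
    (∀ w : TangentSpace 𝓘(ℝ, E) x, Ω x ![v, w] = 0) → v = 0

variable (E) in
/-- `p : N → M` is a universal covering of the smooth manifold `M`: a covering map from a simply
connected manifold which is a local diffeomorphism. -/
structure IsUniversalCovering (p : N → M) : Prop where
  simplyConnected : SimplyConnectedSpace N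
  isCoveringMap : IsCoveringMap p
  surjective : Function.Surjective p
  isLocalDiffeomorph : IsLocalDiffeomorph 𝓘(ℝ, E) 𝓘(ℝ, E) ∞ p

variable [IsManifold 𝓘(ℝ, E) ∞ M]

/-- A smooth Riemannian metric on `M`. -/
abbrev RiemannianMetricOn (E : Type*) [NormedAddCommGroup E] [NormedSpace ℝ E]
    (M : Type*) [TopologicalSpace M] [ChartedSpace E M] [IsManifold 𝓘(ℝ, E) ∞ M] : Type _ :=
  Bundle.ContMDiffRiemannianMetric (IB := 𝓘(ℝ, E)) (n := ∞) (F := E)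
    (E := fun x : M => TangentSpace 𝓘(ℝ, E) x)

/-- The metric `p^* g` induced on `N` by a Riemannian metric `g` on `M` and a map `p : N → M`. -/
def inducedInner (g : RiemannianMetricOn E M) (p : N → M) (x : N)
    (v w : TangentSpace 𝓘(ℝ, E) x) : ℝ :=
  g.inner (p x) (mfderiv 𝓘(ℝ, E) 𝓘(ℝ, E) p x v) (mfderiv 𝓘(ℝ, E) 𝓘(ℝ, E) p x w)

/-- A form `α` on `N` is bounded with respect to the induced metric `p^* g`: its pointwise norm
`|α(x)| = max {|α(x)(X₁, …, X_k)| : |X₁| = … = |X_k| = 1}` is at most some constant `C` for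
every `x`. -/
def IsBoundedForm (g : RiemannianMetricOn E M) (p : N → M) (α : DiffForm E N k) : Prop :=
  ∃ C : ℝ, ∀ (x : N) (X : Fin k → TangentSpace 𝓘(ℝ, E) x),
    (∀ i, inducedInner g p x (X i) (X i) = 1) → |α x X| ≤ C

/-- With `p : N → M` the universal covering of `M`: the pullback `p^* η` is the differential of a
smooth form that is bounded with respect to the metric induced from a Riemannian metric on `M`. -/
def IsDTildeBounded (p : N → M) (η : DiffForm E M (k + 1)) : Prop :=
  ∃ (g : RiemannianMetricOn E M) (α : DiffForm E N k),
    α.IsSmooth ∧ (∀ x, η.pullback p x = α.d x) ∧ IsBoundedForm g p α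

/-- With `p : N → M` the universal covering of `M`: the form `Ω` is symplectic and hyperbolic. -/
def IsSymplecticallyHyperbolic (p : N → M) (Ω : DiffForm E M 2) : Prop :=
  IsSymplectic Ω ∧ IsDTildeBounded p Ω

end Forms

section Amenable

/-- The space of bounded real functions on `G`. -/
def boundedFunctions (G : Type*) : Submodule ℝ (G → ℝ) where
  carrier := {f | ∃ C : ℝ, ∀ x, |f x| ≤ C}
  zero_mem' := ⟨0, fun x => by simp⟩
  add_mem' := by
    rintro f f' ⟨C, hC⟩ ⟨C', hC'⟩
    exact ⟨C + C', fun x => (abs_add_le _ _).trans (add_le_add (hC x) (hC' x))⟩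
  smul_mem' := by
    rintro c f ⟨C, hC⟩
    refine ⟨|c| * C, fun x => ?_⟩
    simpa [abs_mul] using mul_le_mul_of_nonneg_left (hC x) (abs_nonneg c)

/-- A discrete group is amenable if there is a left-invariant mean on its bounded functions: a
positive normalized linear functional that takes the same value at `f` and at `x ↦ f (a * x)`. -/
def IsAmenable (G : Type*) [Group G] : Prop :=
  ∃ m : boundedFunctions G →ₗ[ℝ] ℝ,
    (∀ f : boundedFunctions G, (∀ x, 0 ≤ f.1 x) → 0 ≤ m f) ∧
    (∀ f : boundedFunctions G, (∀ x, f.1 x = 1) → m f = 1) ∧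
    (∀ (a : G) (f f' : boundedFunctions G), (∀ x, f'.1 x = f.1 (a * x)) → m f' = m f)

end Amenable

end SymplecticHyperbolic

end

/-! Let `n` be the dimension of `M`. Solving `Ω(Y, ·) = α` on the covering gives the Liouville field
of the primitive `α`. Cartan's formula shows that it expands the symplectic form at rate one, so its
divergence with respect to the symplectic volume is the constant `n / 2`. Because `α` is bounded and
`M` is compact, `Y` is bounded as well. An invariant mean on the deck group would average `Y` over
the sheets to a field on the closed manifold `M` that still has divergence `n / 2`; but the total
divergence over a closed manifold is zero, while the volume is positive.

The proof never forms the averaged field. Take a finite cover by small sets `U i`, sections `s i g`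
over `U i` indexed by the fundamental group, and a smooth partition of unity `φ i`. Consider the
integrals over `M` of `φ j · dφ i (Y ∘ s i g)` and of `φ j · dφ i (Y ∘ s j g)`. Summed over `j`, the
first give `-(n / 2) ∫ φ i`, by the divergence theorem. Summed over `i`, the second give zero, since
`∑ dφ i = 0`. On an overlap the two sections differ by a translation of the index `g`, so an
invariant mean takes the same value on both families. Summing over all pairs then gives `(n / 2) vol
M = 0`.

The analytic side rests on `integral_fderiv_liouville` and `exists_bound_tderiv_liouville`, the
topological side on `exists_equivariant_sections`, and the averaging on
`not_isAmenable_of_sum_ne_zero`. The volume enters as `√|det|` of the Gram matrix of the form in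
charts, which needs neither wedge powers nor an orientation. -/

noncomputable section

namespace SymplecticHyperbolic

/-! ### Exact symplectic forms on open subsets of a vector space: volume density and divergence. -/

section Euclidean

open MeasureTheory Matrix

variable {E : Type*} [NormedAddCommGroup E] [NormedSpace ℝ E]

/-- Jacobi's formula for the derivative of a determinant. -/
theorem hasFDerivAt_det {ι : Type*} [Fintype ι] [DecidableEq ι] {Q : E → Matrix ι ι ℝ}
    {Q' : ι → ι → E →L[ℝ] ℝ} {y : E}
    (h : ∀ k l, HasFDerivAt (fun z => Q z k l) (Q' k l) y) :
    HasFDerivAt (fun z => (Q z).det) (∑ k, ∑ l, (Q y).adjugate l k • Q' k l) y := by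
  -- As a multilinear function of the rows, the determinant has as derivative the sum of the
  -- determinants with one row replaced; Cramer's rule turns these into adjugate entries.
  let D : ContinuousMultilinearMap ℝ (fun _ : ι => ι → ℝ) ℝ :=
    { toMultilinearMap := (detRowAlternating (n := ι) (R := ℝ)).toMultilinearMap
      cont := by
        exact Continuous.matrix_det (A := fun m : ι → ι → ℝ => Matrix.of m) continuous_id }
  have key := HasFDerivAt.multilinear_comp D (g := fun k z => Q z k)
    (g' := fun k => ContinuousLinearMap.pi (Q' k)) (x := y)
    (fun k => hasFDerivAt_pi.2 (fun l => h k l))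
  refine key.congr_fderiv ?_
  ext v
  simp only [_root_.sum_apply, ContinuousLinearMap.comp_apply,
    _root_.smul_apply, smul_eq_mul]
  refine Finset.sum_congr rfl fun k _ => ?_
  change ((Q y).updateRow k (fun l => Q' k l v)).det = _
  rw [← cramer_transpose_apply, cramer_eq_adjugate_mulVec, ← adjugate_transpose]
  simp only [mulVec, dotProduct, transpose_apply]

/-- Cartan's formula for the Liouville vector field `X` of the exact form `B = da`: the Lie
derivative of `B` along `X` is `B`. -/
theorem lieDerivative_liouville {V : Set E} (hV : IsOpen V)
    {B : E → E →L[ℝ] E →L[ℝ] ℝ} {a : E → E →L[ℝ] ℝ} {X : E → E}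
    (hB : ContDiffOn ℝ ∞ B V) (ha : ContDiffOn ℝ ∞ a V)
    (hd : ∀ y ∈ V, ∀ u v, B y u v = fderiv ℝ a y u v - fderiv ℝ a y v u)
    (hX : ∀ y ∈ V, B y (X y) = a y) (hXs : ContDiffOn ℝ ∞ X V) {y : E} (hy : y ∈ V) (u v : E) :
    fderiv ℝ B y (X y) u v + B y (fderiv ℝ X y u) v + B y u (fderiv ℝ X y v) = B y u v := by
  have hVy := hV.mem_nhds hy
  have hBy := ((hB.contDiffAt hVy).differentiableAt (by simp)).hasFDerivAt
  have hXy := ((hXs.contDiffAt hVy).differentiableAt (by simp)).hasFDerivAt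
  have hay := ha.contDiffAt hVy
  have hda : DifferentiableAt ℝ (fderiv ℝ a) y :=
    (hay.fderiv_right (m := 1) (by norm_cast)).differentiableAt one_ne_zero
  have hsymm : ∀ s t, fderiv ℝ (fderiv ℝ a) y s t = fderiv ℝ (fderiv ℝ a) y t s :=
    fun s t => (hay.isSymmSndFDerivAt (by simp; norm_cast)).eq s t
  have hanti : ∀ s t, B y s t = - B y t s := fun s t => by
    rw [hd y hy, hd y hy]; ring
  -- The derivative of the identity `B z (X z) = a z`.
  have h1 : ∀ s t, fderiv ℝ B y s (X y) t + B y (fderiv ℝ X y s) t = fderiv ℝ a y s t := by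
    intro s t
    have e1 : (fun z => B z (X z)) =ᶠ[nhds y] a := Filter.eventually_of_mem hVy hX
    have e2 := (hBy.clm_apply hXy).fderiv
    rw [e1.fderiv_eq] at e2
    rw [e2]
    simp [add_comm]
  -- Together with the symmetry of the second derivative of `a`, this is the closedness of `B`. It
  -- rewrites the derivative of `B` along `X` through the derivatives along `u` and `v` that occur
  -- in `h1`.
  have h2 : ∀ r s t, fderiv ℝ B y r s t =
      fderiv ℝ (fderiv ℝ a) y r s t - fderiv ℝ (fderiv ℝ a) y r t s := by
    intro r s t
    have e1 : (fun z => B z s t) =ᶠ[nhds y] fun z => fderiv ℝ a z s t - fderiv ℝ a z t s :=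
      Filter.eventually_of_mem hVy fun z hz => hd z hz s t
    have e2 := ((hBy.clm_apply (hasFDerivAt_const s y)).clm_apply (hasFDerivAt_const t y)).fderiv
    have e3 := (((hda.hasFDerivAt.clm_apply (hasFDerivAt_const s y)).clm_apply
      (hasFDerivAt_const t y)).sub ((hda.hasFDerivAt.clm_apply
        (hasFDerivAt_const t y)).clm_apply (hasFDerivAt_const s y))).fderiv
    have e4 := e1.fderiv_eq (𝕜 := ℝ)
    rw [e2] at e4
    have e5 := congrArg (fun f : E →L[ℝ] ℝ => f r) (e4.trans e3)
    simpa using e5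
  have e1 := h1 u v
  have e2 := h1 v u
  have e3 := hd y hy u v
  have e4 := hanti (fderiv ℝ X y v) u
  have e5 := h2 (X y) u v
  have e6 := h2 u (X y) v
  have e7 := h2 v (X y) u
  rw [hsymm u (X y)] at e6
  rw [hsymm v (X y), hsymm v u] at e7
  linarith

theorem contDiff_of_tsupport {F : Type*} [NormedAddCommGroup F] [NormedSpace ℝ F]
    {n : WithTop ℕ∞} {f : E → F} (h : ∀ x ∈ tsupport f, ContDiffAt ℝ n f x) : ContDiff ℝ n f :=
  contMDiff_iff_contDiff.1 (contMDiff_of_tsupport fun x hx => contMDiffAt_iff_contDiffAt.2 (h x hx))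

variable [FiniteDimensional ℝ E]

/-- The Gram matrix of a bilinear form in a fixed basis. -/
def gram (B : E →L[ℝ] E →L[ℝ] ℝ) :
    Matrix (Fin (Module.finrank ℝ E)) (Fin (Module.finrank ℝ E)) ℝ :=
  Matrix.of fun k l => B (Module.finBasis ℝ E k) (Module.finBasis ℝ E l)

/-- The density of the volume determined by a bilinear form. -/
def density (B : E →L[ℝ] E →L[ℝ] ℝ) : ℝ := √|(gram B).det|

/-- A continuous bilinear form as a bilinear form. -/
def bilinForm (B : E →L[ℝ] E →L[ℝ] ℝ) : LinearMap.BilinForm ℝ E :=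
  LinearMap.mk₂ ℝ (fun u v => B u v) (by simp) (by simp) (by simp) (by simp)

theorem toMatrix_bilinForm (B : E →L[ℝ] E →L[ℝ] ℝ) :
    LinearMap.BilinForm.toMatrix (Module.finBasis ℝ E) (bilinForm B) = gram B := by
  ext k l
  simp [LinearMap.BilinForm.toMatrix_apply, gram, bilinForm]

theorem gram_bilinearComp (B : E →L[ℝ] E →L[ℝ] ℝ) (L R : E →L[ℝ] E) :
    gram (B.bilinearComp L R) =
      (LinearMap.toMatrix (Module.finBasis ℝ E) (Module.finBasis ℝ E) L)ᵀ * gram B *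
        LinearMap.toMatrix (Module.finBasis ℝ E) (Module.finBasis ℝ E) R := by
  have h := LinearMap.BilinForm.toMatrix_comp (Module.finBasis ℝ E) (Module.finBasis ℝ E)
    (bilinForm B) L R
  rw [toMatrix_bilinForm] at h
  rw [← h, ← toMatrix_bilinForm]
  rfl

/-- The factor `|det L|` is the one in the change of variables formula; it makes integrals against
the density independent of the chart. -/
theorem density_bilinearComp (B : E →L[ℝ] E →L[ℝ] ℝ) (L : E →L[ℝ] E) :
    density (B.bilinearComp L L) = |L.det| * density B := by
  have h : (gram (B.bilinearComp L L)).det = L.det ^ 2 * (gram B).det := by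
    rw [gram_bilinearComp, det_mul, det_mul, det_transpose, LinearMap.det_toMatrix]
    change LinearMap.det (L : E →ₗ[ℝ] E) * _ * LinearMap.det (L : E →ₗ[ℝ] E) =
      LinearMap.det (L : E →ₗ[ℝ] E) ^ 2 * _
    ring
  rw [density, density, h, abs_mul, Real.sqrt_mul (abs_nonneg _), abs_pow,
    Real.sqrt_sq (abs_nonneg _)]

theorem gram_det_ne_zero {B : E →L[ℝ] E →L[ℝ] ℝ} (hB : ∀ v, (∀ w, B v w = 0) → v = 0) :
    (gram B).det ≠ 0 := by
  have h1 : LinearMap.ker (bilinForm B) = ⊥ := by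
    rw [LinearMap.ker_eq_bot']
    intro v hv
    exact hB v fun w => LinearMap.congr_fun hv w
  have h := (LinearMap.BilinForm.nondegenerate_iff_det_ne_zero (B := bilinForm B)
    (Module.finBasis ℝ E)).1 (LinearMap.BilinForm.nondegenerate_iff_ker_eq_bot.2 h1)
  rwa [toMatrix_bilinForm] at h

theorem density_pos {B : E →L[ℝ] E →L[ℝ] ℝ} (hB : ∀ v, (∀ w, B v w = 0) → v = 0) :
    0 < density B :=
  Real.sqrt_pos.2 (abs_pos.2 (gram_det_ne_zero hB))

theorem density_nonneg (B : E →L[ℝ] E →L[ℝ] ℝ) : 0 ≤ density B := Real.sqrt_nonneg _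

theorem continuous_density : Continuous (density (E := E)) := by
  unfold density gram
  refine Real.continuous_sqrt.comp (continuous_abs.comp (Continuous.matrix_det ?_))
  refine continuous_matrix fun k l => ?_
  simp only [of_apply]
  fun_prop

/-- The derivative of the density along a vector `v`. -/
theorem fderiv_density {B : E → E →L[ℝ] E →L[ℝ] ℝ} {y : E} (hB : DifferentiableAt ℝ B y)
    (hnd : ∀ v, (∀ w, B y v w = 0) → v = 0) :
    DifferentiableAt ℝ (fun z => density (B z)) y ∧ ∀ v,
      fderiv ℝ (fun z => density (B z)) y v =
        density (B y) / 2 * ((gram (B y))⁻¹ * gram (fderiv ℝ B y v)).trace := by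
  have hdet := gram_det_ne_zero hnd
  have hQ : ∀ k l, HasFDerivAt (fun z => gram (B z) k l)
      (((ContinuousLinearMap.apply ℝ ℝ (Module.finBasis ℝ E l)) ∘L
        (ContinuousLinearMap.apply ℝ (E →L[ℝ] ℝ) (Module.finBasis ℝ E k))) ∘L fderiv ℝ B y) y := by
    intro k l
    have e1 := ((hB.hasFDerivAt.clm_apply (hasFDerivAt_const (Module.finBasis ℝ E k) y)).clm_apply
      (hasFDerivAt_const (Module.finBasis ℝ E l) y))
    refine e1.congr_fderiv ?_
    ext v
    simp
  have h1 := hasFDerivAt_det hQ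
  have h2 := ((h1.log hdet).const_mul (1 / 2)).exp
  have hne : ∀ᶠ z in nhds y, (gram (B z)).det ≠ 0 := h1.continuousAt.eventually_ne hdet
  -- Since `Real.log d = Real.log |d|`, the formula covers both signs of the determinant, and
  -- logarithmic differentiation applies without a case split.
  have hform : ∀ {d : ℝ}, d ≠ 0 → √|d| = Real.exp (1 / 2 * Real.log d) := by
    intro d hd
    rw [Real.sqrt_eq_rpow, Real.rpow_def_of_pos (abs_pos.2 hd), Real.log_abs]
    ring_nf
  have h3 := h2.congr_of_eventuallyEq (hne.mono fun z hz => by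
    exact (hform hz : density (B z) = _))
  refine ⟨h3.differentiableAt, fun v => ?_⟩
  rw [show fderiv ℝ (fun z => density (B z)) y = _ from h3.fderiv, ← hform hdet]
  simp only [_root_.smul_apply, _root_.sum_apply,
    ContinuousLinearMap.comp_apply, ContinuousLinearMap.apply_apply, smul_eq_mul,
    Matrix.trace, Matrix.diag, Matrix.mul_apply, Matrix.inv_def, Ring.inverse_eq_inv',
    Matrix.smul_apply]
  rw [Finset.sum_comm]
  simp only [gram, of_apply, density, Finset.mul_sum]
  refine Finset.sum_congr rfl fun k _ => Finset.sum_congr rfl fun l _ => ?_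
  ring

theorem contDiffAt_density {n : WithTop ℕ∞} {B : E → E →L[ℝ] E →L[ℝ] ℝ} {y : E}
    (hB : ContDiffAt ℝ n B y) (hnd : ∀ v, (∀ w, B y v w = 0) → v = 0) :
    ContDiffAt ℝ n (fun z => density (B z)) y := by
  have hdet := gram_det_ne_zero hnd
  have h1 : ContDiffAt ℝ n (fun z => (gram (B z)).det) y := by
    simp only [det_apply, gram, of_apply]
    refine ContDiffAt.sum fun σ _ => ContDiffAt.const_smul _ (contDiffAt_prod fun k _ => ?_)
    exact (hB.clm_apply contDiffAt_const).clm_apply contDiffAt_const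
  simp only [density, ← Real.norm_eq_abs]
  exact (h1.norm ℝ hdet).sqrt (norm_ne_zero_iff.2 hdet)

/-- A compactly supported continuously differentiable vector field has total divergence zero. -/
theorem integral_divergence_eq_zero [MeasurableSpace E] [BorelSpace E] (μ : Measure E)
    [μ.IsAddHaarMeasure] {Z : E → E} (hZ : ContDiff ℝ 1 Z) (hc : HasCompactSupport Z) :
    ∫ y, LinearMap.trace ℝ E (fderiv ℝ Z y) ∂μ = 0 := by
  let b := Module.finBasis ℝ E
  let c : Fin (Module.finrank ℝ E) → E →L[ℝ] ℝ := fun k => (b.coord k).toContinuousLinearMap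
  have hcomp : ∀ k y, fderiv ℝ (fun z => c k (Z z)) y = c k ∘L fderiv ℝ Z y := fun k y =>
    ((c k).hasFDerivAt.comp y (hZ.differentiable one_ne_zero y).hasFDerivAt).fderiv
  have htr : ∀ y, LinearMap.trace ℝ E (fderiv ℝ Z y) =
      ∑ k, fderiv ℝ (fun z => c k (Z z)) y (b k) := by
    intro y
    rw [LinearMap.trace_eq_matrix_trace ℝ b]
    simp only [Matrix.trace, Matrix.diag, LinearMap.toMatrix_apply, hcomp]
    rfl
  have hsm : ∀ k, ContDiff ℝ 1 (fun z => c k (Z z)) := fun k => (c k).contDiff.comp hZ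
  have hcs : ∀ k, HasCompactSupport (fun z => c k (Z z)) := fun k =>
    hc.comp_left (g := c k) (map_zero _)
  have hint : ∀ k, Integrable (fun y => fderiv ℝ (fun z => c k (Z z)) y (b k)) μ := fun k =>
    (((hsm k).continuous_fderiv one_ne_zero).clm_apply continuous_const).integrable_of_hasCompactSupport
      ((hcs k).fderiv_apply (𝕜 := ℝ) (b k))
  simp_rw [htr]
  rw [integral_finsetSum _ fun k _ => hint k]
  refine Finset.sum_eq_zero fun k _ => ?_
  -- Integration by parts against the constant function one.
  have := integral_mul_fderiv_eq_neg_fderiv_mul_of_integrable (μ := μ) (f := fun _ : E => (1 : ℝ))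
    (g := fun z => c k (Z z)) (v := b k) (by simp) (by simpa using hint k)
    (by simpa using (hsm k).continuous.integrable_of_hasCompactSupport (hcs k))
    (fun _ _ => differentiableAt_const _) (fun y _ => (hsm k).differentiable one_ne_zero y)
  simpa using this

/-- The trace identity expressing that the Liouville vector field of an exact symplectic form
expands the form by the factor one. -/
theorem trace_of_lieDerivative_eq {B B' : E →L[ℝ] E →L[ℝ] ℝ} {L : E →L[ℝ] E}
    (hnd : ∀ v, (∀ w, B v w = 0) → v = 0)
    (h : ∀ u v, B' u v + B (L u) v + B u (L v) = B u v) :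
    ((gram B)⁻¹ * gram B').trace + 2 * LinearMap.trace ℝ E L = Module.finrank ℝ E := by
  have hdet := gram_det_ne_zero hnd
  have hu : IsUnit (gram B).det := hdet.isUnit
  set P := LinearMap.toMatrix (Module.finBasis ℝ E) (Module.finBasis ℝ E) L with hP
  have h1 := gram_bilinearComp B L (ContinuousLinearMap.id ℝ E)
  have h2 := gram_bilinearComp B (ContinuousLinearMap.id ℝ E) L
  rw [ContinuousLinearMap.coe_id, LinearMap.toMatrix_id] at h1 h2
  rw [transpose_one, one_mul] at h2
  rw [mul_one] at h1
  have h3 : gram B' + Pᵀ * gram B + gram B * P = gram B := by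
    rw [← h1, ← h2]
    ext k l
    exact h _ _
  -- After multiplication by the inverse Gram matrix, each of the two terms containing `P` has trace
  -- `tr P`, by cyclicity and invariance under transposition.
  have h4 := congrArg (fun X => ((gram B)⁻¹ * X).trace) h3
  simp only [mul_add, trace_add] at h4
  rw [nonsing_inv_mul _ hu, ← mul_assoc _ (gram B) P, nonsing_inv_mul _ hu, one_mul,
    trace_one, Fintype.card_fin, ← mul_assoc, trace_mul_comm ((gram B)⁻¹ * Pᵀ), ← mul_assoc,
    mul_nonsing_inv _ hu, one_mul, trace_transpose] at h4
  rw [LinearMap.trace_eq_matrix_trace ℝ (Module.finBasis ℝ E), ← hP]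
  linarith

theorem exists_equiv_of_nondegenerate {B : E →L[ℝ] E →L[ℝ] ℝ}
    (hnd : ∀ v, (∀ w, B v w = 0) → v = 0) : ∃ e : E ≃L[ℝ] (E →L[ℝ] ℝ), (e : E →L[ℝ] E →L[ℝ] ℝ) = B := by
  have hinj : Function.Injective (B : E →ₗ[ℝ] E →L[ℝ] ℝ) := by
    rw [← LinearMap.ker_eq_bot, LinearMap.ker_eq_bot']
    intro v hv
    exact hnd v fun w => congrArg (fun f : E →L[ℝ] ℝ => f w) hv
  have hfr : Module.finrank ℝ E = Module.finrank ℝ (E →L[ℝ] ℝ) := by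
    rw [← (LinearMap.toContinuousLinearMap (𝕜 := ℝ) (E := E) (F' := ℝ)).finrank_eq]
    exact (Subspace.dual_finrank_eq (K := ℝ) (V := E)).symm
  refine ⟨(LinearMap.linearEquivOfInjective _ hinj hfr).toContinuousLinearEquiv, ?_⟩
  ext v w
  rfl

/-- Solutions of `B X = a` depend smoothly on smooth coefficients. -/
theorem contDiffOn_of_nondegenerate {n : WithTop ℕ∞} {V : Set E}
    {B : E → E →L[ℝ] E →L[ℝ] ℝ} {a : E → E →L[ℝ] ℝ} {X : E → E}
    (hB : ContDiffOn ℝ n B V) (ha : ContDiffOn ℝ n a V)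
    (hnd : ∀ y ∈ V, ∀ v, (∀ w, B y v w = 0) → v = 0)
    (hX : ∀ y ∈ V, B y (X y) = a y) : ContDiffOn ℝ n X V := by
  have hX' : ∀ y ∈ V, X y = (B y).inverse (a y) := by
    intro y hy
    obtain ⟨e, he⟩ := exists_equiv_of_nondegenerate (hnd y hy)
    rw [← hX y hy, ← he, ContinuousLinearMap.inverse_equiv]
    simp
  refine ContDiffOn.congr (fun y hy => ?_) hX'
  obtain ⟨e, he⟩ := exists_equiv_of_nondegenerate (hnd y hy)
  refine ContDiffWithinAt.clm_apply ?_ (ha y hy)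
  have h := contDiffAt_map_inverse (n := n) e
  rw [he] at h
  exact h.comp_contDiffWithinAt y (hB y hy)

/-- The Liouville vector field of an exact symplectic form on an open subset of a vector space
has constant divergence, half of the dimension, with respect to the volume of the form. -/
theorem integral_fderiv_liouville [MeasurableSpace E] [BorelSpace E] (μ : Measure E)
    [μ.IsAddHaarMeasure] {V : Set E} (hV : IsOpen V)
    {B : E → E →L[ℝ] E →L[ℝ] ℝ} {a : E → E →L[ℝ] ℝ} {X : E → E} {φ : E → ℝ}
    (hB : ContDiffOn ℝ ∞ B V) (ha : ContDiffOn ℝ ∞ a V)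
    (hd : ∀ y ∈ V, ∀ u v, B y u v = fderiv ℝ a y u v - fderiv ℝ a y v u)
    (hnd : ∀ y ∈ V, ∀ v, (∀ w, B y v w = 0) → v = 0)
    (hX : ∀ y ∈ V, B y (X y) = a y)
    (hφ : ContDiff ℝ ∞ φ) (hc : HasCompactSupport φ) (hs : tsupport φ ⊆ V) :
    ∫ y, fderiv ℝ φ y (X y) * density (B y) ∂μ =
      -(Module.finrank ℝ E / 2 * ∫ y, φ y * density (B y) ∂μ) := by
  have hXs := contDiffOn_of_nondegenerate hB ha hnd hX
  have hρ : ∀ y ∈ V, ContDiffAt ℝ ∞ (fun z => density (B z)) y := fun y hy =>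
    contDiffAt_density (hB.contDiffAt (hV.mem_nhds hy)) (hnd y hy)
  have hφρ : ContDiff ℝ ∞ (fun y => φ y * density (B y)) :=
    contDiff_of_tsupport fun y hy =>
      hφ.contDiffAt.mul (hρ y (hs (closure_mono (Function.support_mul_subset_left _ _) hy)))
  have hφρc : HasCompactSupport (fun y => φ y * density (B y)) := hc.mul_right
  have hZ : ContDiff ℝ ∞ (fun y => (φ y * density (B y)) • X y) :=
    contDiff_of_tsupport fun y hy => by
      have hy' : y ∈ tsupport φ := closure_mono ((Function.support_smul_subset_left _ _).trans
        (Function.support_mul_subset_left _ _)) hy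
      exact hφρ.contDiffAt.smul (hXs.contDiffAt (hV.mem_nhds (hs hy')))
  have hZc : HasCompactSupport (fun y => (φ y * density (B y)) • X y) := hφρc.smul_right
  -- The product rule for the divergence of `φ ρ X`, where `ρ` is the density: Jacobi's formula and
  -- the trace identity give `dρ(X) + ρ div X = (n / 2) ρ`. Off the support of `φ` both sides
  -- vanish.
  have htr : ∀ y, LinearMap.trace ℝ E (fderiv ℝ (fun y => (φ y * density (B y)) • X y) y) =
      fderiv ℝ φ y (X y) * density (B y) + Module.finrank ℝ E / 2 * (φ y * density (B y)) := by
    intro y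
    by_cases hy : y ∈ tsupport φ
    · have hyV := hs hy
      have hVy := hV.mem_nhds hyV
      have hφy := (hφ.differentiable (by simp) y).hasFDerivAt
      obtain ⟨hρd, hρ'⟩ := fderiv_density ((hB.contDiffAt hVy).differentiableAt (by simp))
        (hnd y hyV)
      have hXy := ((hXs.contDiffAt hVy).differentiableAt (by simp)).hasFDerivAt
      have hform := ((hφy.mul hρd.hasFDerivAt).smul hXy).fderiv
      have htrace := trace_of_lieDerivative_eq (hnd y hyV)
        (lieDerivative_liouville hV hB ha hd hX hXs hyV)
      have hrank : ∀ (f : E →L[ℝ] ℝ) (x : E),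
          LinearMap.trace ℝ E (f.smulRight x : E →L[ℝ] E) = f x := fun f x =>
        LinearMap.trace_smulRight (f : E →ₗ[ℝ] ℝ) x
      have hform' := congrArg (fun T : E →L[ℝ] E => LinearMap.trace ℝ E T) hform
      simp only [ContinuousLinearMap.toLinearMap_add, map_add, hrank, ContinuousLinearMap.toLinearMap_smul,
        map_smul, _root_.add_apply, _root_.smul_apply, smul_eq_mul, hρ', Pi.mul_apply] at hform'
      refine Eq.trans hform' ?_
      linear_combination (φ y * density (B y) / 2) * htrace
    · have h0 : φ =ᶠ[nhds y] 0 := notMem_tsupport_iff_eventuallyEq.1 hy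
      have h1 : (fun y => (φ y * density (B y)) • X y) =ᶠ[nhds y] fun _ => 0 :=
        h0.mono fun z hz => by simp [hz]
      rw [h1.fderiv_eq, h0.fderiv_eq, h0.self_of_nhds]
      simp
  have hdiv := integral_divergence_eq_zero μ (hZ.of_le (by norm_cast)) hZc
  have hint1 : Integrable (fun y => φ y * density (B y)) μ :=
    hφρ.continuous.integrable_of_hasCompactSupport hφρc
  have hint2 : Integrable (fun y => LinearMap.trace ℝ E
      (fderiv ℝ (fun y => (φ y * density (B y)) • X y) y)) μ := by
    let T : (E →L[ℝ] E) →L[ℝ] ℝ := LinearMap.toContinuousLinearMap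
      ((LinearMap.trace ℝ E) ∘ₗ (ContinuousLinearMap.coeLM ℝ))
    refine Continuous.integrable_of_hasCompactSupport
      (T.continuous.comp (hZ.continuous_fderiv (by simp))) ?_
    exact (hZc.fderiv (𝕜 := ℝ)).comp_left (g := T) (map_zero T)
  have : ∀ y, fderiv ℝ φ y (X y) * density (B y) =
      LinearMap.trace ℝ E (fderiv ℝ (fun y => (φ y * density (B y)) • X y) y) -
        Module.finrank ℝ E / 2 * (φ y * density (B y)) := fun y => by
    rw [htr]; ring
  simp_rw [this]
  rw [integral_sub hint2 (hint1.const_mul _), hdiv, integral_const_mul, zero_sub]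

end Euclidean

/-! ### Sections of a covering map indexed by the fundamental group. -/

section Sections

variable {M N : Type*} [TopologicalSpace M] [TopologicalSpace N] {p : N → M}

/-- `t` is a continuous section of `p` over `W`. -/
structure IsSectionOn (p : N → M) (t : M → N) (W : Set M) : Prop where
  continuousOn : ContinuousOn t W
  right_inv : ∀ x ∈ W, p (t x) = x

theorem IsSectionOn.mono {t : M → N} {W U : Set M} (h : IsSectionOn p t W) (hU : U ⊆ W) :
    IsSectionOn p t U :=
  ⟨h.continuousOn.mono hU, fun x hx => h.right_inv x (hU hx)⟩

/-- Through every point over `W` there is a section of `p` over `W`. -/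
def HasSectionsOn (p : N → M) (W : Set M) : Prop :=
  ∀ z, p z ∈ W → ∃ t, IsSectionOn p t W ∧ t (p z) = z

/-- Over an evenly covered neighbourhood, the sheet containing the given point is the image of a
section. -/
theorem exists_hasSectionsOn (cov : IsCoveringMap p) (x : M) :
    ∃ W, IsOpen W ∧ x ∈ W ∧ HasSectionsOn p W := by
  obtain ⟨_, W, hxW, hW, -, H, hH⟩ := cov x
  refine ⟨W, hW, hxW, fun z hz => ?_⟩
  classical
  let k := (H ⟨z, hz⟩).2
  have hmem : ∀ y : W, p (H.symm (y, k)) = y := fun y => by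
    have := hH (H.symm (y, k))
    rw [H.apply_symm_apply] at this
    exact this.symm
  refine ⟨fun y => if hy : y ∈ W then H.symm (⟨y, hy⟩, k) else z, ⟨?_, fun y hy => ?_⟩, ?_⟩
  · rw [continuousOn_iff_continuous_domRestrict]
    have : W.domRestrict (fun y => if hy : y ∈ W then (H.symm (⟨y, hy⟩, k) : N) else z) =
        fun y => (H.symm (y, k) : N) := by
      ext y
      simp [Set.domRestrict]
    rw [this]
    exact continuous_subtype_val.comp
      (H.symm.continuous.comp (continuous_id.prodMk continuous_const))
  · simp only [hy, dif_pos]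
    exact hmem ⟨y, hy⟩
  · simp only [hz, dif_pos]
    have : ((⟨p z, hz⟩ : W), k) = H ⟨z, hz⟩ := by
      refine Prod.ext (Subtype.ext ?_) rfl
      exact (hH ⟨z, hz⟩).symm
    rw [this, H.symm_apply_apply]

/-- A section composed with the path is a lift of it, and lifts with given starting point are
unique. -/
theorem monodromy_eq_of_section (cov : IsCoveringMap p) {t : M → N} {W : Set M}
    (ht : IsSectionOn p t W) {x y : M} (γ : Path x y) (hγ : ∀ r, γ r ∈ W) (e : p ⁻¹' {x})
    (he : t x = e) : (cov.monodromy (.mk γ) e : N) = t y := by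
  have h : (fun r => t (γ r)) = cov.liftPath γ e (γ.source.trans e.2.symm) := by
    rw [cov.eq_liftPath_iff]
    refine ⟨ht.continuousOn.comp_continuous γ.continuous hγ, ?_, ?_⟩
    · ext r
      exact ht.right_inv _ (hγ r)
    · simpa using he
  have h1 := congrFun h 1
  simp only [γ.target] at h1
  exact h1.symm

/-- The section with index `g` over `U i` is obtained by lifting the loop `g`, then a fixed path to
a base point of `U i`, then paths inside `U i`. Since `U i ∪ U j` lies in a set with sections, the
comparison on the overlap needs a single loop `a`, even if `U i ∩ U j` is disconnected. -/
theorem exists_equivariant_sections [PathConnectedSpace M] (cov : IsCoveringMap p)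
    (hp : Function.Surjective p) (x₀ : M) {ι : Type*} (U : ι → Set M)
    (hU : ∀ i, IsPathConnected (U i))
    (hW : ∀ i j, (U i ∩ U j).Nonempty → ∃ W, U i ∪ U j ⊆ W ∧ HasSectionsOn p W) :
    ∃ s : ι → FundamentalGroup M x₀ → M → N, (∀ i g, IsSectionOn p (s i g) (U i)) ∧
      (∀ i g x, p (s i g x) = x) ∧ ∀ i j, (U i ∩ U j).Nonempty → ∃ a : FundamentalGroup M x₀, ∀ g, ∀ x ∈ U i ∩ U j,
        s i g x = s j (a * g) x := by
  classical
  obtain ⟨n₀, hn₀⟩ := hp x₀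
  choose c hc hjoin using hU
  choose q hq using hp
  let C : ∀ i, Path x₀ (c i) := fun i => PathConnectedSpace.somePath x₀ (c i)
  let R : ∀ i x, x ∈ U i → Path (c i) x := fun i x hx => (hjoin i hx).somePath
  have hR : ∀ i x hx r, R i x hx r ∈ U i := fun i x hx r => (hjoin i hx).somePath_mem r
  let e : ∀ i, FundamentalGroup M x₀ → p ⁻¹' {c i} := fun i g =>
    cov.monodromy (.mk (C i)) (cov.monodromy g.toPath ⟨n₀, hn₀⟩)
  -- The default `q x` also lies over `x`, so `p (s i g x) = x` holds on all of `M`, not only on `U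
  -- i`.
  let s : ι → FundamentalGroup M x₀ → M → N := fun i g x =>
    if hx : x ∈ U i then cov.monodromy (.mk (R i x hx)) (e i g) else q x
  have hs : ∀ {W t} i g, U i ⊆ W → IsSectionOn p t W → t (c i) = e i g →
      ∀ x ∈ U i, s i g x = t x := by
    intro W t i g hUW ht hte x hx
    simp only [s, hx, dif_pos]
    exact monodromy_eq_of_section cov (ht.mono hUW) _ (hR i x hx) _ hte
  have hpe : ∀ i g, p (e i g) = c i := fun i g => (e i g).2
  refine ⟨s, fun i g => ?_, fun i g x => ?_, fun i j hij => ?_⟩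
  · obtain ⟨W, hUW, hsec⟩ := hW i i ⟨c i, hc i, hc i⟩
    rw [Set.union_self] at hUW
    obtain ⟨t, ht, hte⟩ := hsec (e i g) (by rw [hpe]; exact hUW (hc i))
    rw [hpe] at hte
    have h := hs i g hUW ht hte
    exact ⟨(ht.continuousOn.mono hUW).congr h, fun x hx => by
      rw [h x hx]; exact ht.right_inv x (hUW hx)⟩
  · by_cases hx : x ∈ U i
    · simp only [s, hx, dif_pos]
      exact (cov.monodromy (.mk (R i x hx)) (e i g)).2
    · simp only [s, hx, dif_neg, not_false_eq_true, hq]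
  · obtain ⟨W, hUW, hsec⟩ := hW i j hij
    obtain ⟨y, hyi, hyj⟩ := hij
    -- The class `κ` joins the two base points through a point of the overlap; closing it up along
    -- the reference paths gives the loop `a`.
    let κ : Path.Homotopic.Quotient (c i) (c j) :=
      (Path.Homotopic.Quotient.mk (R i y hyi)).trans (Path.Homotopic.Quotient.mk (R j y hyj).symm)
    let a : Path.Homotopic.Quotient x₀ x₀ :=
      ((Path.Homotopic.Quotient.mk (C i)).trans κ).trans (Path.Homotopic.Quotient.mk (C j)).symm
    refine ⟨FundamentalGroup.fromPath a, fun g x hx => ?_⟩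
    have hUi : U i ⊆ W := Set.subset_union_left.trans hUW
    have hUj : U j ⊆ W := Set.subset_union_right.trans hUW
    obtain ⟨t, ht, hte⟩ := hsec (e i g) (by rw [hpe]; exact hUi (hc i))
    rw [hpe] at hte
    have he : e j (FundamentalGroup.fromPath a * g) = cov.monodromy κ (e i g) := by
      -- In this convention the right factor is traversed first, which is why the transition acts by
      -- left multiplication.
      have h1 : (FundamentalGroup.fromPath a * g).toPath =
          Path.Homotopic.Quotient.trans g.toPath a := rfl
      simp only [e]
      rw [h1]
      simp only [a, cov.monodromy_trans_apply]
      rw [← cov.monodromy_trans_apply _ (Path.Homotopic.Quotient.mk (C j)),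
        Path.Homotopic.Quotient.symm_trans, cov.monodromy_refl]
      rfl
    have hy : (cov.monodromy (.mk (R i y hyi)) (e i g) : N) = t y :=
      monodromy_eq_of_section cov (ht.mono hUi) _ (hR i y hyi) _ hte
    have hte' : t (c j) = e j (FundamentalGroup.fromPath a * g) := by
      rw [he]
      simp only [κ, cov.monodromy_trans_apply]
      exact (monodromy_eq_of_section cov (ht.mono hUj) (R j y hyj).symm
        (fun r => hR j y hyj _) _ hy.symm).symm
    rw [hs i g hUi ht hte x hx.1, hs j _ hUj ht hte' x hx.2]

end Sections

/-! ### Forms in charts, their pullbacks, and integration against the symplectic density. -/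

section Charts

open MeasureTheory Topology

variable {E : Type*} [NormedAddCommGroup E] [NormedSpace ℝ E]
variable {E' : Type*} [NormedAddCommGroup E'] [NormedSpace ℝ E']
variable {E'' : Type*} [NormedAddCommGroup E''] [NormedSpace ℝ E'']

/-- A `1`-form as a linear functional. -/
def toLinear : (E [⋀^Fin 1]→L[ℝ] ℝ) ≃ₗᵢ[ℝ] (E →L[ℝ] ℝ) :=
  (ContinuousAlternatingMap.ofSubsingletonLIE (𝕜 := ℝ) (E := E) (F := ℝ) (0 : Fin 1)).symm

theorem toLinear_apply (A : E [⋀^Fin 1]→L[ℝ] ℝ) (v : E) : toLinear A v = A ![v] := by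
  change A _ = A _
  congr 1
  ext i
  fin_cases i
  rfl

theorem toLinear_comp (A : E [⋀^Fin 1]→L[ℝ] ℝ) (L : E' →L[ℝ] E) :
    toLinear (A.compContinuousLinearMap L) = toLinear A ∘L L := rfl

theorem extDeriv_apply_two {A : E → E [⋀^Fin 1]→L[ℝ] ℝ} {y : E} (hA : DifferentiableAt ℝ A y)
    (u v : E) : extDeriv A y ![u, v] =
      fderiv ℝ (fun z => toLinear (A z)) y u v - fderiv ℝ (fun z => toLinear (A z)) y v u := by
  have hd : fderiv ℝ (fun z => toLinear (A z)) y =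
      (toLinear (E := E)).toContinuousLinearEquiv.toContinuousLinearMap ∘L fderiv ℝ A y :=
    ((toLinear (E := E)).toContinuousLinearEquiv.toContinuousLinearMap.hasFDerivAt.comp y
      hA.hasFDerivAt).fderiv
  have h1 : ∀ u v, fderiv ℝ (fun z => toLinear (A z)) y u v = fderiv ℝ A y u ![v] := fun u v => by
    rw [hd]
    exact toLinear_apply _ _
  rw [h1, h1, extDeriv, ContinuousAlternatingMap.alternatizeUncurryFin_apply, Fin.sum_univ_two]
  have e0 : Fin.removeNth 0 ![u, v] = ![v] := by ext i; fin_cases i; rfl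
  have e1 : Fin.removeNth 1 ![u, v] = ![u] := by ext i; fin_cases i; rfl
  rw [e0, e1]
  simp [sub_eq_add_neg]

variable {M : Type*} [TopologicalSpace M] [ChartedSpace E M]
variable {N : Type*} [TopologicalSpace N] [ChartedSpace E' N]
variable {P : Type*} [TopologicalSpace P] [ChartedSpace E'' P]

/-- The derivative of a map between manifolds, as a map between the model spaces. -/
def tderiv (f : M → N) (x : M) : E →L[ℝ] E' := mfderiv 𝓘(ℝ, E) 𝓘(ℝ, E') f x

theorem tderiv_comp {g : N → P} {f : M → N} {x : M}
    (hg : ContMDiffAt 𝓘(ℝ, E') 𝓘(ℝ, E'') ∞ g (f x)) (hf : ContMDiffAt 𝓘(ℝ, E) 𝓘(ℝ, E') ∞ f x) :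
    tderiv (E := E) (E' := E'') (fun w => g (f w)) x =
      tderiv (E := E') (E' := E'') g (f x) ∘L tderiv (E := E) (E' := E') f x :=
  mfderiv_comp x (hg.mdifferentiableAt (by simp)) (hf.mdifferentiableAt (by simp))

theorem tderiv_congr {f g : M → N} {x : M} (h : f =ᶠ[𝓝 x] g) :
    tderiv (E := E) (E' := E') f x = tderiv (E := E) (E' := E') g x :=
  h.mfderiv_eq

theorem tderiv_eq_fderiv {f : E → E'} {y : E} :
    tderiv (E := E) (E' := E') f y = fderiv ℝ f y :=
  mfderiv_eq_fderiv

/-- The value of a form at a point, as an alternating form on the model space. -/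
def formAt {k : ℕ} (η : DiffForm E M k) (x : M) : E [⋀^Fin k]→L[ℝ] ℝ := η x

theorem inChart_eq {k : ℕ} (η : DiffForm E M k) (x : M) (y : E) :
    η.inChart x y = (formAt η ((extChartAt 𝓘(ℝ, E) x).symm y)).compContinuousLinearMap
      (tderiv (E := E) (E' := E) (extChartAt 𝓘(ℝ, E) x).symm y) := rfl

theorem formAt_d {k : ℕ} (η : DiffForm E M k) (x : M) :
    formAt η.d x = (extDeriv (η.inChart x) (extChartAt 𝓘(ℝ, E) x x)).compContinuousLinearMap
      (tderiv (E := E) (E' := E) (extChartAt 𝓘(ℝ, E) x) x) := rfl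

theorem comp_comp {k : ℕ} (η : E'' [⋀^Fin k]→L[ℝ] ℝ) (g : E' →L[ℝ] E'') (f : E →L[ℝ] E') :
    (η.compContinuousLinearMap g).compContinuousLinearMap f =
      η.compContinuousLinearMap (g ∘L f) := rfl

section Smooth

variable [IsManifold 𝓘(ℝ, E) ∞ M]

theorem contMDiffAt_extChartAt_symm (x : M) {y : E} (hy : y ∈ (extChartAt 𝓘(ℝ, E) x).target) :
    ContMDiffAt 𝓘(ℝ, E) 𝓘(ℝ, E) ∞ (extChartAt 𝓘(ℝ, E) x).symm y :=
  (contMDiffOn_extChartAt_symm x).contMDiffAt ((isOpen_extChartAt_target x).mem_nhds hy)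

theorem contMDiffAt_extChartAt_of_mem (x : M) {z : M} (hz : z ∈ (extChartAt 𝓘(ℝ, E) x).source) :
    ContMDiffAt 𝓘(ℝ, E) 𝓘(ℝ, E) ∞ (extChartAt 𝓘(ℝ, E) x) z :=
  contMDiffAt_extChartAt' (by simpa using hz)

theorem tderiv_extChartAt_right_inv (x : M) {y : E}
    (hy : y ∈ (extChartAt 𝓘(ℝ, E) x).target) (v : E) :
    tderiv (E := E) (E' := E) (extChartAt 𝓘(ℝ, E) x).symm y
      (tderiv (E := E) (E' := E) (extChartAt 𝓘(ℝ, E) x) ((extChartAt 𝓘(ℝ, E) x).symm y) v) = v := by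
  have : IsManifold 𝓘(ℝ, E) 1 M := IsManifold.of_le (n := ∞) (by norm_cast)
  have h := mfderivWithin_extChartAt_symm_comp_mfderiv_extChartAt (I := 𝓘(ℝ, E)) hy
  rw [ModelWithCorners.range_eq_univ, mfderivWithin_univ] at h
  exact congrArg (fun T : E →L[ℝ] E => T v) h

theorem tderiv_extChartAt_left_inv (x : M) {y : E}
    (hy : y ∈ (extChartAt 𝓘(ℝ, E) x).target) (v : E) :
    tderiv (E := E) (E' := E) (extChartAt 𝓘(ℝ, E) x) ((extChartAt 𝓘(ℝ, E) x).symm y)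
      (tderiv (E := E) (E' := E) (extChartAt 𝓘(ℝ, E) x).symm y v) = v := by
  have : IsManifold 𝓘(ℝ, E) 1 M := IsManifold.of_le (n := ∞) (by norm_cast)
  have h := mfderiv_extChartAt_comp_mfderivWithin_extChartAt_symm (I := 𝓘(ℝ, E)) hy
  rw [ModelWithCorners.range_eq_univ, mfderivWithin_univ] at h
  exact congrArg (fun T : E →L[ℝ] E => T v) h

/-- The exterior derivative commutes with the pullback of a `1`-form under a smooth map from a
vector space. -/
theorem extDeriv_pullback_of_contMDiffOn {α : DiffForm E M 1} (hα : α.IsSmooth) {F : E → M}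
    {V : Set E} (hV : IsOpen V) (hF : ∀ y ∈ V, ContMDiffAt 𝓘(ℝ, E) 𝓘(ℝ, E) ∞ F y)
    {y : E} (hy : y ∈ V) :
    DifferentiableAt ℝ (fun w => (formAt α (F w)).compContinuousLinearMap
      (tderiv (E := E) (E' := E) F w)) y ∧
    ContDiffAt ℝ ∞ (fun w => toLinear ((formAt α (F w)).compContinuousLinearMap
      (tderiv (E := E) (E' := E) F w))) y ∧
    extDeriv (fun w => (formAt α (F w)).compContinuousLinearMap
      (tderiv (E := E) (E' := E) F w)) y =
      (formAt α.d (F y)).compContinuousLinearMap (tderiv (E := E) (E' := E) F y) := by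
  -- The chart centred at `F y` is the one that defines `α.d (F y)`, so the claim reduces to
  -- naturality of `extDeriv` under `G = χ ∘ F`, with no change of chart.
  set χ := extChartAt 𝓘(ℝ, E) (F y) with hχ
  let G : E → E := fun w => χ (F w)
  have hev : ∀ᶠ w in 𝓝 y, w ∈ V ∧ F w ∈ χ.source :=
    (hV.eventually_mem hy).and ((hF y hy).continuousAt.eventually_mem
      (extChartAt_source_mem_nhds (F y)))
  have hGs : ∀ w, w ∈ V ∧ F w ∈ χ.source → ContMDiffAt 𝓘(ℝ, E) 𝓘(ℝ, E) ∞ G w := fun w hw =>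
    ContMDiffAt.comp w (contMDiffAt_extChartAt_of_mem _ hw.2) (hF w hw.1)
  have hAeq : (fun w => (formAt α (F w)).compContinuousLinearMap
      (tderiv (E := E) (E' := E) F w)) =ᶠ[𝓝 y]
      fun w => (α.inChart (F y) (G w)).compContinuousLinearMap (fderiv ℝ G w) := by
    filter_upwards [hev.eventually_nhds] with w hw
    have hw0 := hw.self_of_nhds
    have h1 : (fun w => χ.symm (G w)) =ᶠ[𝓝 w] F := hw.mono fun v hv => χ.left_inv hv.2
    have h2 : tderiv (E := E) (E' := E) F w =
        tderiv (E := E) (E' := E) χ.symm (G w) ∘L fderiv ℝ G w := by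
      rw [← tderiv_congr h1, ← tderiv_eq_fderiv]
      exact tderiv_comp (contMDiffAt_extChartAt_symm _ (χ.map_source hw0.2)) (hGs w hw0)
    rw [inChart_eq, comp_comp, h2, ← hχ, show χ.symm (G w) = F w from χ.left_inv hw0.2]
  have hy0 := hev.self_of_nhds
  have hGy : ContDiffAt ℝ ∞ G y := contMDiffAt_iff_contDiffAt.1 (hGs y hy0)
  have hαy : ContDiffAt ℝ ∞ (α.inChart (F y)) (G y) :=
    (hα (F y)).contDiffAt ((isOpen_extChartAt_target (F y)).mem_nhds (χ.map_source hy0.2))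
  have hG' : ContDiffAt ℝ ∞ (fderiv ℝ G) y := hGy.fderiv_right (by norm_cast)
  refine ⟨?_, ?_, ?_⟩
  · refine DifferentiableAt.congr_of_eventuallyEq ?_ hAeq
    exact DifferentiableAt.continuousAlternatingMapCompContinuousLinearMap
      ((hαy.comp y hGy).differentiableAt (by simp)) (hG'.differentiableAt (by simp))
  · refine ContDiffAt.congr_of_eventuallyEq ?_ (hAeq.fun_comp toLinear)
    change ContDiffAt ℝ ∞ (fun w => toLinear (α.inChart (F y) (G w)) ∘L fderiv ℝ G w) y
    exact ((toLinear (E := E)).contDiff.contDiffAt.comp y (hαy.comp y hGy)).clm_comp hG'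
  · rw [hAeq.extDeriv_eq, extDeriv_pullback (hαy.differentiableAt (by simp)) hGy
      (by simp; norm_cast), formAt_d, comp_comp, ← tderiv_eq_fderiv]
    congr 1
    exact tderiv_comp (contMDiffAt_extChartAt_of_mem _ hy0.2) (hF y hy)

end Smooth

/-- Near each point a continuous section coincides with a local inverse of `p`. -/
theorem IsSectionOn.contMDiffAt {N : Type*} [TopologicalSpace N] [ChartedSpace E N] {p : N → M}
    (hp : IsLocalDiffeomorph 𝓘(ℝ, E) 𝓘(ℝ, E) ∞ p) {s : M → N} {U : Set M}
    (hs : IsSectionOn p s U) (hU : IsOpen U) {x : M} (hx : x ∈ U) :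
    ContMDiffAt 𝓘(ℝ, E) 𝓘(ℝ, E) ∞ s x := by
  obtain ⟨Φ, hΦ, hΦp⟩ := hp (s x)
  have hc : ContinuousAt s x := hs.continuousOn.continuousAt (hU.mem_nhds hx)
  have hev : s =ᶠ[𝓝 x] Φ.symm := by
    filter_upwards [hc.eventually_mem (Φ.open_source.mem_nhds hΦ), hU.mem_nhds hx] with w hw hwU
    have h1 := Φ.left_inv hw
    have h2 : Φ (s w) = w := (hΦp hw).symm.trans (hs.right_inv w hwU)
    exact (congrArg Φ.symm h2).symm.trans h1 |>.symm
  have hx' : x ∈ Φ.target := by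
    have h2 : Φ (s x) = x := (hΦp hΦ).symm.trans (hs.right_inv x hx)
    rw [← h2]
    exact Φ.map_source hΦ
  exact (Φ.symm.contMDiffOn.contMDiffAt (Φ.open_target.mem_nhds hx')).congr_of_eventuallyEq hev

/-- A `2`-form as a bilinear form. -/
def toBilinear (Ω : E [⋀^Fin 2]→L[ℝ] ℝ) : E →L[ℝ] E →L[ℝ] ℝ :=
  (toLinear (E := E)).toContinuousLinearEquiv.toContinuousLinearMap ∘L Ω.curryLeft

theorem toBilinear_apply (Ω : E [⋀^Fin 2]→L[ℝ] ℝ) (u v : E) : toBilinear Ω u v = Ω ![u, v] :=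
  toLinear_apply _ _

theorem toBilinear_comp (Ω : E [⋀^Fin 2]→L[ℝ] ℝ) (L : E →L[ℝ] E) :
    toBilinear (Ω.compContinuousLinearMap L) = (toBilinear Ω).bilinearComp L L := by
  ext u v
  rw [toBilinear_apply, ContinuousLinearMap.bilinearComp_apply, toBilinear_apply]
  change Ω (L ∘ ![u, v]) = _
  congr 1
  ext i
  fin_cases i <;> rfl

variable [FiniteDimensional ℝ E]

theorem contDiffOn_toBilinear {n : WithTop ℕ∞} {Ω : E → E [⋀^Fin 2]→L[ℝ] ℝ} {V : Set E}
    (h : ContDiffOn ℝ n Ω V) : ContDiffOn ℝ n (fun y => toBilinear (Ω y)) V := by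
  rw [contDiffOn_clm_apply]
  intro u
  rw [contDiffOn_clm_apply]
  intro v
  simp only [toBilinear_apply]
  exact ((ContinuousAlternatingMap.apply ℝ E ℝ ![u, v]).contDiff).comp_contDiffOn h

variable [IsManifold 𝓘(ℝ, E) ∞ M]

/-- The symplectic density in the chart around `x`. -/
def chartDensity (Ω : DiffForm E M 2) (x : M) (y : E) : ℝ := density (toBilinear (Ω.inChart x y))

/-- Integration over the domain of the chart around `x` against the symplectic density. -/
def chartIntegral [MeasurableSpace E] (μ : Measure E) (Ω : DiffForm E M 2) (x : M) (h : M → ℝ) :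
    ℝ :=
  ∫ y in (extChartAt 𝓘(ℝ, E) x).target,
    h ((extChartAt 𝓘(ℝ, E) x).symm y) * chartDensity Ω x y ∂μ

/-- Change of variables under the transition map `τ`, whose Jacobian is exactly the ratio of the two
densities. -/
theorem chartIntegral_eq [MeasurableSpace E] [BorelSpace E] (μ : Measure E) [μ.IsAddHaarMeasure]
    (Ω : DiffForm E M 2) (x x' : M) (h : M → ℝ)
    (hs : ∀ z, h z ≠ 0 → z ∈ (extChartAt 𝓘(ℝ, E) x).source ∧ z ∈ (extChartAt 𝓘(ℝ, E) x').source) :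
    chartIntegral μ Ω x h = chartIntegral μ Ω x' h := by
  set χ := extChartAt 𝓘(ℝ, E) x with hχ
  set χ' := extChartAt 𝓘(ℝ, E) x' with hχ'
  set S := χ.target ∩ χ.symm ⁻¹' χ'.source with hS
  set S' := χ'.target ∩ χ'.symm ⁻¹' χ.source with hS'
  have hSo : IsOpen S := (continuousOn_extChartAt_symm x).isOpen_inter_preimage
    (isOpen_extChartAt_target x) (isOpen_extChartAt_source x')
  let τ : E → E := fun y => χ' (χ.symm y)
  have himg : τ '' S = S' := by
    ext y'
    constructor
    · rintro ⟨y, ⟨hy, hy'⟩, rfl⟩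
      refine ⟨χ'.map_source hy', ?_⟩
      change χ'.symm (χ' (χ.symm y)) ∈ χ.source
      rw [χ'.left_inv hy']
      exact χ.map_target hy
    · rintro ⟨hy, hy'⟩
      refine ⟨χ (χ'.symm y'), ⟨χ.map_source hy', ?_⟩, ?_⟩
      · change χ.symm (χ (χ'.symm y')) ∈ χ'.source
        rw [χ.left_inv hy']
        exact χ'.map_target hy
      · change χ' (χ.symm (χ (χ'.symm y'))) = y'
        rw [χ.left_inv hy', χ'.right_inv hy]
  have hinj : Set.InjOn τ S := by
    intro y hy w hw hyw
    have h1 := χ'.injOn hy.2 hw.2 hyw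
    exact χ.symm.injOn hy.1 hw.1 h1
  have hτs : ∀ y ∈ S, ContMDiffAt 𝓘(ℝ, E) 𝓘(ℝ, E) ∞ τ y := fun y hy =>
    ContMDiffAt.comp y (contMDiffAt_extChartAt_of_mem x' hy.2)
      (contMDiffAt_extChartAt_symm x hy.1)
  have hτ : ∀ y ∈ S, DifferentiableAt ℝ τ y := fun y hy =>
    (contMDiffAt_iff_contDiffAt.1 (hτs y hy)).differentiableAt (by simp)
  have hinv : ∀ y ∈ S, χ'.symm (τ y) = χ.symm y := fun y hy => χ'.left_inv hy.2
  have hdens : ∀ y ∈ S, chartDensity Ω x y = |(fderiv ℝ τ y).det| * chartDensity Ω x' (τ y) := by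
    intro y hy
    have hev : (fun w => χ'.symm (τ w)) =ᶠ[𝓝 y] χ.symm :=
      Filter.eventually_of_mem (hSo.mem_nhds hy) hinv
    have hτy : τ y ∈ χ'.target := χ'.map_source hy.2
    have hD : tderiv (E := E) (E' := E) χ.symm y =
        tderiv (E := E) (E' := E) χ'.symm (τ y) ∘L fderiv ℝ τ y := by
      rw [← tderiv_eq_fderiv, ← tderiv_congr hev]
      exact tderiv_comp (contMDiffAt_extChartAt_symm x' hτy) (hτs y hy)
    have hform : Ω.inChart x y = (Ω.inChart x' (τ y)).compContinuousLinearMap (fderiv ℝ τ y) := by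
      rw [inChart_eq, inChart_eq, comp_comp, ← hχ, ← hχ', hD, hinv y hy]
    rw [chartDensity, hform, toBilinear_comp, density_bilinearComp]
    rfl
  have e1 : chartIntegral μ Ω x h = ∫ y in S, h (χ.symm y) * chartDensity Ω x y ∂μ := by
    refine (setIntegral_eq_of_subset_of_forall_sdiff_eq_zero
      (isOpen_extChartAt_target x).measurableSet Set.inter_subset_left fun y hy => ?_)
    by_cases h0 : h (χ.symm y) = 0
    · rw [h0, zero_mul]
    · exact absurd ⟨hy.1, (hs _ h0).2⟩ hy.2
  have e2 : chartIntegral μ Ω x' h = ∫ y in S', h (χ'.symm y) * chartDensity Ω x' y ∂μ := by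
    refine (setIntegral_eq_of_subset_of_forall_sdiff_eq_zero
      (isOpen_extChartAt_target x').measurableSet Set.inter_subset_left fun y hy => ?_)
    by_cases h0 : h (χ'.symm y) = 0
    · rw [h0, zero_mul]
    · exact absurd ⟨hy.1, (hs _ h0).1⟩ hy.2
  rw [e1, e2, ← himg, integral_image_eq_integral_abs_det_fderiv_smul μ hSo.measurableSet
    (fun y hy => (hτ y hy).hasFDerivAt.hasFDerivWithinAt) hinj]
  refine setIntegral_congr_fun hSo.measurableSet fun y hy => ?_
  simp only [smul_eq_mul]
  rw [hdens y hy, hinv y hy]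
  ring

end Charts

/-! ### The Liouville field on the covering and its divergence in charts of `M`. -/

section Liouville

open MeasureTheory Topology

variable {E : Type*} [NormedAddCommGroup E] [NormedSpace ℝ E]
variable {M : Type*} [TopologicalSpace M] [ChartedSpace E M]
variable {N : Type*} [TopologicalSpace N] [ChartedSpace E N]

/-- A function on the manifold in the chart around `x`, extended by zero. -/
def inChartZero (φ : M → ℝ) (x : M) : E → ℝ :=
  (extChartAt 𝓘(ℝ, E) x).target.indicator fun y => φ ((extChartAt 𝓘(ℝ, E) x).symm y)

section InChartZero

variable {φ : M → ℝ} {x : M}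

theorem inChartZero_eventuallyEq {y : E} (hy : y ∈ (extChartAt 𝓘(ℝ, E) x).target) :
    inChartZero φ x =ᶠ[𝓝 y] fun y => φ ((extChartAt 𝓘(ℝ, E) x).symm y) :=
  Filter.eventually_of_mem ((isOpen_extChartAt_target x).mem_nhds hy) fun _ hw =>
    Set.indicator_of_mem hw _

theorem isCompact_image_tsupport [CompactSpace M] (hsupp : tsupport φ ⊆ (extChartAt 𝓘(ℝ, E) x).source) :
    IsCompact (extChartAt 𝓘(ℝ, E) x '' tsupport φ) :=
  (isClosed_tsupport φ).isCompact.image_of_continuousOn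
    ((continuousOn_extChartAt x).mono hsupp)

theorem image_tsupport_subset {U : Set M} (hU : U ⊆ (extChartAt 𝓘(ℝ, E) x).source)
    (hsupp : tsupport φ ⊆ U) : extChartAt 𝓘(ℝ, E) x '' tsupport φ ⊆
      (extChartAt 𝓘(ℝ, E) x).target ∩ (extChartAt 𝓘(ℝ, E) x).symm ⁻¹' U := by
  rintro _ ⟨z, hz, rfl⟩
  refine ⟨(extChartAt 𝓘(ℝ, E) x).map_source (hU (hsupp hz)), ?_⟩
  change (extChartAt 𝓘(ℝ, E) x).symm _ ∈ U
  rw [(extChartAt 𝓘(ℝ, E) x).left_inv (hU (hsupp hz))]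
  exact hsupp hz

theorem notMem_tsupport_of_notMem_image {y : E}
    (hy : y ∈ (extChartAt 𝓘(ℝ, E) x).target)
    (hy' : y ∉ extChartAt 𝓘(ℝ, E) x '' tsupport φ) :
    (extChartAt 𝓘(ℝ, E) x).symm y ∉ tsupport φ := fun h =>
  hy' ⟨_, h, (extChartAt 𝓘(ℝ, E) x).right_inv hy⟩

theorem tsupport_inChartZero [CompactSpace M] (hsupp : tsupport φ ⊆ (extChartAt 𝓘(ℝ, E) x).source) :
    tsupport (inChartZero (E := E) φ x) ⊆ extChartAt 𝓘(ℝ, E) x '' tsupport φ := by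
  refine closure_minimal (fun y hy => ?_) (isCompact_image_tsupport hsupp).isClosed
  by_contra hy'
  refine hy ?_
  by_cases hT : y ∈ (extChartAt 𝓘(ℝ, E) x).target
  · rw [inChartZero, Set.indicator_of_mem hT]
    exact image_eq_zero_of_notMem_tsupport (notMem_tsupport_of_notMem_image hT hy')
  · exact Set.indicator_of_notMem hT _

theorem hasCompactSupport_inChartZero [CompactSpace M] (hsupp : tsupport φ ⊆ (extChartAt 𝓘(ℝ, E) x).source) :
    HasCompactSupport (inChartZero (E := E) φ x) :=
  (isCompact_image_tsupport hsupp).of_isClosed_subset (isClosed_tsupport _)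
    (tsupport_inChartZero hsupp)

theorem integrableOn_of_tsupport [CompactSpace M] [MeasurableSpace E] [BorelSpace E]
    (μ : Measure E) [IsFiniteMeasureOnCompacts μ]
    (hsupp : tsupport φ ⊆ (extChartAt 𝓘(ℝ, E) x).source) {f : E → ℝ}
    (hf : ContinuousOn f (extChartAt 𝓘(ℝ, E) x '' tsupport φ))
    (hf0 : ∀ y ∈ (extChartAt 𝓘(ℝ, E) x).target, (extChartAt 𝓘(ℝ, E) x).symm y ∉ tsupport φ →
      f y = 0) : IntegrableOn f (extChartAt 𝓘(ℝ, E) x).target μ := by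
  have hK := isCompact_image_tsupport hsupp
  refine IntegrableOn.of_forall_sdiff_eq_zero (hf.integrableOn_compact hK)
    (isOpen_extChartAt_target x).measurableSet fun y hy => ?_
  exact hf0 y hy.1 (notMem_tsupport_of_notMem_image hy.1 hy.2)

theorem tderiv_eq_zero_of_notMem_tsupport {z : M} (hz : z ∉ tsupport φ) :
    tderiv (E := E) (E' := ℝ) φ z = 0 := by
  rw [tderiv_congr (g := fun _ => (0 : ℝ)) (notMem_tsupport_iff_eventuallyEq.1 hz)]
  exact mfderiv_const

variable [IsManifold 𝓘(ℝ, E) ∞ M]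

theorem fderiv_inChartZero (hφ : ContMDiff 𝓘(ℝ, E) 𝓘(ℝ, ℝ) ∞ φ) {y : E}
    (hy : y ∈ (extChartAt 𝓘(ℝ, E) x).target) (v : E) :
    fderiv ℝ (inChartZero φ x) y (tderiv (E := E) (E' := E) (extChartAt 𝓘(ℝ, E) x)
      ((extChartAt 𝓘(ℝ, E) x).symm y) v) =
      tderiv (E := E) (E' := ℝ) φ ((extChartAt 𝓘(ℝ, E) x).symm y) v := by
  rw [(inChartZero_eventuallyEq hy).fderiv_eq, ← tderiv_eq_fderiv,
    tderiv_comp hφ.contMDiffAt (contMDiffAt_extChartAt_symm x hy), ContinuousLinearMap.comp_apply,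
    tderiv_extChartAt_right_inv x hy]

theorem contDiff_inChartZero [CompactSpace M] (hφ : ContMDiff 𝓘(ℝ, E) 𝓘(ℝ, ℝ) ∞ φ)
    (hsupp : tsupport φ ⊆ (extChartAt 𝓘(ℝ, E) x).source) : ContDiff ℝ ∞ (inChartZero (E := E) φ x) := by
  refine contDiff_of_tsupport fun y hy => ?_
  have hy' : y ∈ (extChartAt 𝓘(ℝ, E) x).target :=
    (image_tsupport_subset subset_rfl hsupp (tsupport_inChartZero hsupp hy)).1
  refine ContDiffAt.congr_of_eventuallyEq ?_ (inChartZero_eventuallyEq hy')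
  exact contMDiffAt_iff_contDiffAt.1 (hφ.contMDiffAt.comp y (contMDiffAt_extChartAt_symm x hy'))

end InChartZero

/-- `Y` is the push-forward to `M` of the Liouville vector field of the primitive `α` of the
pullback of `Ω` under `p`. -/
def IsLiouville (p : N → M) (Ω : DiffForm E M 2) (α : DiffForm E N 1) (Y : N → E) : Prop :=
  ∀ z v, formAt Ω (p z) ![Y z, tderiv (E := E) (E' := E) p z v] = formAt α z ![v]

section Primitive

variable [IsManifold 𝓘(ℝ, E) ∞ M] [IsManifold 𝓘(ℝ, E) ∞ N]

/-- The Liouville vector field along a section, in the chart around `x`. -/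
def chartLiouville (Y : N → E) (s : M → N) (x : M) (y : E) : E :=
  tderiv (E := E) (E' := E) (extChartAt 𝓘(ℝ, E) x) ((extChartAt 𝓘(ℝ, E) x).symm y)
    (Y (s ((extChartAt 𝓘(ℝ, E) x).symm y)))

/-- The primitive is the pullback of `α` under `F = s ∘ χ⁻¹`. As `p ∘ F = χ⁻¹`, its exterior
derivative is `Ω` read in the chart, and the defining equation of `Y` becomes `B X = a`. -/
theorem exists_chart_primitive {p : N → M} (hp : IsLocalDiffeomorph 𝓘(ℝ, E) 𝓘(ℝ, E) ∞ p)
    {Ω : DiffForm E M 2} {α : DiffForm E N 1} (hα : α.IsSmooth)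
    (hd : ∀ z, Ω.pullback p z = α.d z) {Y : N → E} (hY : IsLiouville p Ω α Y)
    {s : M → N} {U : Set M} (hs : IsSectionOn p s U) (hU : IsOpen U) (x : M) :
    ∃ a : E → E →L[ℝ] ℝ,
      ContDiffOn ℝ ∞ a ((extChartAt 𝓘(ℝ, E) x).target ∩ (extChartAt 𝓘(ℝ, E) x).symm ⁻¹' U) ∧
      ∀ y ∈ (extChartAt 𝓘(ℝ, E) x).target ∩ (extChartAt 𝓘(ℝ, E) x).symm ⁻¹' U,
        (∀ u v, toBilinear (Ω.inChart x y) u v = fderiv ℝ a y u v - fderiv ℝ a y v u) ∧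
        toBilinear (Ω.inChart x y) (chartLiouville Y s x y) = a y := by
  set χ := extChartAt 𝓘(ℝ, E) x with hχ
  let F : E → N := fun y => s (χ.symm y)
  have hV : IsOpen (χ.target ∩ χ.symm ⁻¹' U) :=
    (continuousOn_extChartAt_symm x).isOpen_inter_preimage (isOpen_extChartAt_target x) hU
  have hF : ∀ y ∈ χ.target ∩ χ.symm ⁻¹' U, ContMDiffAt 𝓘(ℝ, E) 𝓘(ℝ, E) ∞ F y := fun y hy =>
    ContMDiffAt.comp y (hs.contMDiffAt hp hU hy.2) (contMDiffAt_extChartAt_symm x hy.1)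
  have hpF : ∀ y ∈ χ.target ∩ χ.symm ⁻¹' U, p (F y) = χ.symm y := fun y hy =>
    hs.right_inv _ hy.2
  have hDF : ∀ y ∈ χ.target ∩ χ.symm ⁻¹' U, tderiv (E := E) (E' := E) χ.symm y =
      tderiv (E := E) (E' := E) p (F y) ∘L tderiv (E := E) (E' := E) F y := fun y hy => by
    rw [← tderiv_comp (hp (F y)).contMDiffAt (hF y hy)]
    exact tderiv_congr (Filter.eventually_of_mem (hV.mem_nhds hy) fun w hw => (hpF w hw).symm)
  refine ⟨fun w => toLinear ((formAt α (F w)).compContinuousLinearMap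
    (tderiv (E := E) (E' := E) F w)), fun y hy => ?_, fun y hy => ⟨fun u v => ?_, ?_⟩⟩
  · exact (extDeriv_pullback_of_contMDiffOn hα hV hF hy).2.1.contDiffWithinAt
  · obtain ⟨h1, -, h3⟩ := extDeriv_pullback_of_contMDiffOn hα hV hF hy
    rw [← extDeriv_apply_two h1, h3, toBilinear_apply]
    congr 1
    have h4 : formAt α.d (F y) = (formAt Ω (p (F y))).compContinuousLinearMap
        (tderiv (E := E) (E' := E) p (F y)) := (hd (F y)).symm
    rw [h4, comp_comp, ← hDF y hy, hpF y hy, inChart_eq]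
  · ext v
    change _ = toLinear ((formAt α (F y)).compContinuousLinearMap
      (tderiv (E := E) (E' := E) F y)) v
    rw [toLinear_comp, ContinuousLinearMap.comp_apply, toLinear_apply, ← hY, inChart_eq,
      toBilinear_comp, ContinuousLinearMap.bilinearComp_apply, chartLiouville, ← hχ,
      tderiv_extChartAt_right_inv x hy.1, toBilinear_apply, hDF y hy, hpF y hy]
    rfl

end Primitive

theorem IsSymplectic.toBilinear_nondegenerate {Ω : DiffForm E M 2} (hΩ : IsSymplectic Ω) (x : M)
    (v : E) (hv : ∀ w, toBilinear (formAt Ω x) v w = 0) : v = 0 :=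
  hΩ.nondegenerate x v fun w => (toBilinear_apply (formAt Ω x) v w).symm.trans (hv w)

theorem nondegenerate_inChart [IsManifold 𝓘(ℝ, E) ∞ M] {Ω : DiffForm E M 2} (hΩ : IsSymplectic Ω)
    (x : M) {y : E} (hy : y ∈ (extChartAt 𝓘(ℝ, E) x).target) (v : E)
    (hv : ∀ w, toBilinear (Ω.inChart x y) v w = 0) : v = 0 := by
  rw [inChart_eq, toBilinear_comp] at hv
  have h0 : tderiv (E := E) (E' := E) (extChartAt 𝓘(ℝ, E) x).symm y v = 0 := by
    refine hΩ.toBilinear_nondegenerate ((extChartAt 𝓘(ℝ, E) x).symm y) _ fun w => ?_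
    have h := hv (tderiv (E := E) (E' := E) (extChartAt 𝓘(ℝ, E) x)
      ((extChartAt 𝓘(ℝ, E) x).symm y) w)
    rwa [ContinuousLinearMap.bilinearComp_apply, tderiv_extChartAt_right_inv x hy] at h
  rw [← tderiv_extChartAt_left_inv x hy v, h0, map_zero]

variable [FiniteDimensional ℝ E]

/-- Pointwise linear algebra: `Ω` identifies vectors with covectors and the derivative of `p` is
invertible. Smoothness is recovered in charts from `contDiffOn_of_nondegenerate`. -/
theorem exists_isLiouville {p : N → M} (hp : IsLocalDiffeomorph 𝓘(ℝ, E) 𝓘(ℝ, E) ∞ p)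
    {Ω : DiffForm E M 2} (hΩ : IsSymplectic Ω) (α : DiffForm E N 1) :
    ∃ Y, IsLiouville p Ω α Y := by
  have key : ∀ z, ∃ Yz : E, ∀ v,
      formAt Ω (p z) ![Yz, tderiv (E := E) (E' := E) p z v] = formAt α z ![v] := by
    intro z
    obtain ⟨e, he⟩ := exists_equiv_of_nondegenerate (B := toBilinear (formAt Ω (p z)))
      (hΩ.toBilinear_nondegenerate (p z))
    let D : E ≃L[ℝ] E := (hp z).mfderivToContinuousLinearEquiv (by simp)
    have hD : ∀ v, D v = tderiv (E := E) (E' := E) p z v := fun v => by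
      have h := (hp z).mfderivToContinuousLinearEquiv_coe (by simp)
      exact congrArg (fun T : E →L[ℝ] E => T v) h
    refine ⟨e.symm (toLinear (formAt α z) ∘L (D.symm : E →L[ℝ] E)), fun v => ?_⟩
    rw [← toBilinear_apply, ← he, ← hD]
    simp [toLinear_apply]
  exact ⟨fun z => (key z).choose, fun z => (key z).choose_spec⟩

theorem contDiffOn_inChart {Ω : DiffForm E M 2} (hΩ : IsSymplectic Ω) (x : M) :
    ContDiffOn ℝ ∞ (fun y => toBilinear (Ω.inChart x y)) (extChartAt 𝓘(ℝ, E) x).target :=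
  contDiffOn_toBilinear (hΩ.smooth x)

theorem continuousOn_chartDensity {Ω : DiffForm E M 2} (hΩ : IsSymplectic Ω) (x : M) :
    ContinuousOn (chartDensity Ω x) (extChartAt 𝓘(ℝ, E) x).target :=
  continuous_density.comp_continuousOn (contDiffOn_inChart hΩ x).continuousOn

theorem chartIntegral_nonneg [MeasurableSpace E] [BorelSpace E] (μ : Measure E)
    (Ω : DiffForm E M 2) (x : M) {h : M → ℝ} (hh : ∀ z, 0 ≤ h z) :
    0 ≤ chartIntegral μ Ω x h :=
  setIntegral_nonneg (isOpen_extChartAt_target x).measurableSet fun _ _ =>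
    mul_nonneg (hh _) (density_nonneg _)

/-- Chart integrals of uniformly bounded functions with support in a fixed compact subset of the
chart are uniformly bounded. -/
theorem exists_chartIntegral_bound [CompactSpace M] [MeasurableSpace E] [BorelSpace E]
    (μ : Measure E) [μ.IsAddHaarMeasure] {Ω : DiffForm E M 2} (hΩ : IsSymplectic Ω) {x : M}
    {φ : M → ℝ}
    (hsupp : tsupport φ ⊆ (extChartAt 𝓘(ℝ, E) x).source) (C : ℝ) :
    ∃ D, ∀ h : M → ℝ, (∀ z, |h z| ≤ C) → (∀ z ∉ tsupport φ, h z = 0) →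
      |chartIntegral μ Ω x h| ≤ D := by
  have hsub := (image_tsupport_subset subset_rfl hsupp).trans Set.inter_subset_left
  have hK := isCompact_image_tsupport hsupp
  refine ⟨∫ y in extChartAt 𝓘(ℝ, E) x '' tsupport φ, C * chartDensity Ω x y ∂μ,
    fun h hC h0 => ?_⟩
  have e1 : chartIntegral μ Ω x h = ∫ y in extChartAt 𝓘(ℝ, E) x '' tsupport φ,
      h ((extChartAt 𝓘(ℝ, E) x).symm y) * chartDensity Ω x y ∂μ :=
    setIntegral_eq_of_subset_of_forall_sdiff_eq_zero
      (isOpen_extChartAt_target x).measurableSet hsub fun y hy => by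
        rw [h0 _ (notMem_tsupport_of_notMem_image hy.1 hy.2), zero_mul]
  rw [e1, ← Real.norm_eq_abs]
  -- No measurability of `h` is needed: a non-integrable integrand has integral zero.
  refine norm_integral_le_of_norm_le ?_ (Filter.Eventually.of_forall fun y => ?_)
  · exact (((continuousOn_chartDensity hΩ x).mono hsub).integrableOn_compact hK).const_mul C
  · rw [norm_mul, Real.norm_eq_abs, Real.norm_of_nonneg (r := chartDensity Ω x y) (density_nonneg _)]
    exact mul_le_mul_of_nonneg_right (hC _) (density_nonneg _)

variable [IsManifold 𝓘(ℝ, E) ∞ M] [CompactSpace M] [IsManifold 𝓘(ℝ, E) ∞ N]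
variable [MeasurableSpace E] [BorelSpace E] (μ : Measure E) [μ.IsAddHaarMeasure]

/-- The Liouville vector field has divergence half of the dimension. -/
theorem chartIntegral_tderiv_liouville {p : N → M}
    (hp : IsLocalDiffeomorph 𝓘(ℝ, E) 𝓘(ℝ, E) ∞ p)
    {Ω : DiffForm E M 2} (hΩ : IsSymplectic Ω) {α : DiffForm E N 1} (hα : α.IsSmooth)
    (hd : ∀ z, Ω.pullback p z = α.d z) {Y : N → E} (hY : IsLiouville p Ω α Y)
    {s : M → N} {U : Set M} (hs : IsSectionOn p s U) (hU : IsOpen U) {x : M}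
    (hUx : U ⊆ (extChartAt 𝓘(ℝ, E) x).source)
    {φ : M → ℝ} (hφ : ContMDiff 𝓘(ℝ, E) 𝓘(ℝ, ℝ) ∞ φ) (hsupp : tsupport φ ⊆ U) :
    chartIntegral μ Ω x (fun z => tderiv (E := E) (E' := ℝ) φ z (Y (s z))) =
      -(Module.finrank ℝ E / 2 * chartIntegral μ Ω x φ) := by
  obtain ⟨a, ha, hda⟩ := exists_chart_primitive hp hα hd hY hs hU x
  have hsupp' := hsupp.trans hUx
  have hV : IsOpen ((extChartAt 𝓘(ℝ, E) x).target ∩ (extChartAt 𝓘(ℝ, E) x).symm ⁻¹' U) :=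
    (continuousOn_extChartAt_symm x).isOpen_inter_preimage (isOpen_extChartAt_target x) hU
  have key := integral_fderiv_liouville μ hV
    ((contDiffOn_inChart hΩ x).mono Set.inter_subset_left) ha (fun y hy => (hda y hy).1)
    (fun y hy => nondegenerate_inChart hΩ x hy.1) (fun y hy => (hda y hy).2)
    (contDiff_inChartZero hφ hsupp') (hasCompactSupport_inChartZero hsupp')
    ((tsupport_inChartZero hsupp').trans (image_tsupport_subset hUx hsupp))
  have hT := (isOpen_extChartAt_target (I := 𝓘(ℝ, E)) x).measurableSet
  have hts : ∀ y, y ∉ (extChartAt 𝓘(ℝ, E) x).target → y ∉ tsupport (inChartZero φ x) :=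
    fun y hy h => hy (image_tsupport_subset hUx hsupp (tsupport_inChartZero hsupp' h)).1
  have e1 : chartIntegral μ Ω x (fun z => tderiv (E := E) (E' := ℝ) φ z (Y (s z))) =
      ∫ y, fderiv ℝ (inChartZero φ x) y (chartLiouville Y s x y) *
        density (toBilinear (Ω.inChart x y)) ∂μ := by
    rw [← setIntegral_eq_integral_of_forall_compl_eq_zero
      (s := (extChartAt 𝓘(ℝ, E) x).target)]
    · refine setIntegral_congr_fun hT fun y hy => ?_
      simp only [chartLiouville]
      rw [fderiv_inChartZero hφ hy]
      rfl
    · intro y hy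
      rw [(notMem_tsupport_iff_eventuallyEq.1 (hts y hy)).fderiv_eq]
      simp
  have e2 : chartIntegral μ Ω x φ =
      ∫ y, inChartZero φ x y * density (toBilinear (Ω.inChart x y)) ∂μ := by
    rw [← setIntegral_eq_integral_of_forall_compl_eq_zero
      (s := (extChartAt 𝓘(ℝ, E) x).target)]
    · refine setIntegral_congr_fun hT fun y hy => ?_
      simp only [inChartZero]
      rw [Set.indicator_of_mem hy]
      rfl
    · intro y hy
      rw [image_eq_zero_of_notMem_tsupport (hts y hy), zero_mul]
  rw [e1, e2, key]

theorem chartIntegral_pos {Ω : DiffForm E M 2} (hΩ : IsSymplectic Ω) {x : M} {φ : M → ℝ}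
    (hφ : Continuous φ) (hφ0 : ∀ z, 0 ≤ φ z)
    (hsupp : tsupport φ ⊆ (extChartAt 𝓘(ℝ, E) x).source) {z : M} (hz : φ z ≠ 0) :
    0 < chartIntegral μ Ω x φ := by
  have hψ := continuousOn_extChartAt_symm (I := 𝓘(ℝ, E)) x
  have hTo := isOpen_extChartAt_target (I := 𝓘(ℝ, E)) x
  have hc : ContinuousOn (fun y => φ ((extChartAt 𝓘(ℝ, E) x).symm y) * chartDensity Ω x y)
      (extChartAt 𝓘(ℝ, E) x).target :=
    (hφ.comp_continuousOn hψ).mul (continuousOn_chartDensity hΩ x)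
  have hint := integrableOn_of_tsupport μ hsupp
    (hc.mono ((image_tsupport_subset subset_rfl hsupp).trans Set.inter_subset_left))
    (fun y _ hy => by rw [image_eq_zero_of_notMem_tsupport hy, zero_mul])
  refine (setIntegral_pos_iff_support_of_nonneg_ae ?_ hint).2 ?_
  · exact Filter.Eventually.of_forall fun y => mul_nonneg (hφ0 _) (density_nonneg _)
  · have hzs : z ∈ (extChartAt 𝓘(ℝ, E) x).source := hsupp (subset_closure hz)
    have hopen : IsOpen ((extChartAt 𝓘(ℝ, E) x).target ∩
        (fun y => φ ((extChartAt 𝓘(ℝ, E) x).symm y)) ⁻¹' {0}ᶜ) :=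
      (hφ.comp_continuousOn hψ).isOpen_inter_preimage hTo isOpen_compl_singleton
    refine lt_of_lt_of_le (hopen.measure_pos μ ⟨extChartAt 𝓘(ℝ, E) x z,
      (extChartAt 𝓘(ℝ, E) x).map_source hzs, ?_⟩) (measure_mono ?_)
    · change φ ((extChartAt 𝓘(ℝ, E) x).symm (extChartAt 𝓘(ℝ, E) x z)) ≠ 0
      rwa [(extChartAt 𝓘(ℝ, E) x).left_inv hzs]
    · rintro y ⟨hy, hy'⟩
      exact ⟨mul_ne_zero hy' (density_pos (nondegenerate_inChart hΩ x hy)).ne', hy⟩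

/-- Integrability of the derivative of a function along the Liouville vector field. -/
theorem integrableOn_tderiv_liouville {p : N → M}
    (hp : IsLocalDiffeomorph 𝓘(ℝ, E) 𝓘(ℝ, E) ∞ p)
    {Ω : DiffForm E M 2} (hΩ : IsSymplectic Ω) {α : DiffForm E N 1} (hα : α.IsSmooth)
    (hd : ∀ z, Ω.pullback p z = α.d z) {Y : N → E} (hY : IsLiouville p Ω α Y)
    {s : M → N} {U : Set M} (hs : IsSectionOn p s U) (hU : IsOpen U) {x : M}
    (hUx : U ⊆ (extChartAt 𝓘(ℝ, E) x).source)
    {φ f : M → ℝ} (hφ : ContMDiff 𝓘(ℝ, E) 𝓘(ℝ, ℝ) ∞ φ) (hf : Continuous f) {θ : M → ℝ}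
    (hsupp : tsupport θ ⊆ U) (hθ : ∀ z ∉ tsupport θ, f z • tderiv (E := E) (E' := ℝ) φ z = 0) :
    IntegrableOn (fun y => (fun z => f z * tderiv (E := E) (E' := ℝ) φ z (Y (s z)))
      ((extChartAt 𝓘(ℝ, E) x).symm y) * chartDensity Ω x y) (extChartAt 𝓘(ℝ, E) x).target μ := by
  obtain ⟨a, ha, hda⟩ := exists_chart_primitive hp hα hd hY hs hU x
  have hTo := isOpen_extChartAt_target (I := 𝓘(ℝ, E)) x
  have hX := (contDiffOn_of_nondegenerate
    ((contDiffOn_inChart hΩ x).mono Set.inter_subset_left) ha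
    (fun y hy => nondegenerate_inChart hΩ x hy.1) (fun y hy => (hda y hy).2)).continuousOn
  have hφ' : ContinuousOn (fderiv ℝ (inChartZero φ x)) (extChartAt 𝓘(ℝ, E) x).target := by
    refine ContDiffOn.continuousOn_fderiv_of_isOpen (n := ∞) (fun y hy => ?_) hTo (by norm_cast)
    refine ContDiffAt.contDiffWithinAt
      (ContDiffAt.congr_of_eventuallyEq ?_ (inChartZero_eventuallyEq hy))
    exact contMDiffAt_iff_contDiffAt.1
      (hφ.contMDiffAt.comp y (contMDiffAt_extChartAt_symm x hy))
  refine integrableOn_of_tsupport μ (hsupp.trans hUx) ?_ fun y hy hyθ => ?_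
  · refine ContinuousOn.mono ?_ (image_tsupport_subset hUx hsupp)
    refine ContinuousOn.mul (ContinuousOn.mul ?_ ?_)
      ((continuousOn_chartDensity hΩ x).mono Set.inter_subset_left)
    · exact (hf.comp_continuousOn (continuousOn_extChartAt_symm x)).mono Set.inter_subset_left
    · refine ((hφ'.mono Set.inter_subset_left).clm_apply hX).congr fun y hy => ?_
      exact (fderiv_inChartZero hφ hy.1 _).symm
  · have h := congrArg (fun T : E →L[ℝ] ℝ => T (Y (s ((extChartAt 𝓘(ℝ, E) x).symm y))))
      (hθ _ hyθ)
    simp only [_root_.smul_apply, smul_eq_mul, _root_.zero_apply] at h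
    simp only [h, zero_mul]

end Liouville

/-! ### Boundedness of the Liouville field of a bounded primitive. -/

section Bound

open Topology

variable {E : Type*} [NormedAddCommGroup E] [NormedSpace ℝ E]
variable {M : Type*} [TopologicalSpace M] [ChartedSpace E M] [IsManifold 𝓘(ℝ, E) ∞ M]
variable {N : Type*} [TopologicalSpace N] [ChartedSpace E N]

/-- The value of a metric at a point, as a bilinear form on the model space. -/
def metricAt (g : RiemannianMetricOn E M) (x : M) : E →L[ℝ] E →L[ℝ] ℝ := g.inner x

theorem metricAt_pos (g : RiemannianMetricOn E M) (x : M) {v : E} (hv : v ≠ 0) :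
    0 < metricAt g x v v := g.pos x v hv

open scoped Bundle in
/-- A Riemannian metric is locally bounded in a chart. -/
theorem exists_metric_bound (g : RiemannianMetricOn E M) (x : M) :
    ∃ C > 0, ∀ᶠ w in 𝓝 x, ∀ v : E,
      metricAt g w (tderiv (E := E) (E' := E) (extChartAt 𝓘(ℝ, E) x).symm
          (extChartAt 𝓘(ℝ, E) x w) v)
        (tderiv (E := E) (E' := E) (extChartAt 𝓘(ℝ, E) x).symm (extChartAt 𝓘(ℝ, E) x w) v) ≤
        (C * ‖v‖) ^ 2 := by
  have : IsManifold 𝓘(ℝ, E) 1 M := IsManifold.of_le (n := ∞) (by norm_cast)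
  let _ : Bundle.RiemannianBundle (fun x : M => TangentSpace 𝓘(ℝ, E) x) :=
    ⟨g.toRiemannianMetric⟩
  have : IsContinuousRiemannianBundle E (fun x : M => TangentSpace 𝓘(ℝ, E) x) :=
    ⟨⟨g.inner, g.contMDiff.continuous, fun _ _ _ => rfl⟩⟩
  obtain ⟨C, hC, hev⟩ := eventually_norm_symmL_trivializationAt_lt E
    (fun x : M => TangentSpace 𝓘(ℝ, E) x) x
  refine ⟨C, hC, ?_⟩
  have hsrc : ∀ᶠ w in 𝓝 x, w ∈ (chartAt E x).source :=
    (chartAt E x).open_source.mem_nhds (mem_chart_source E x)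
  filter_upwards [hev, hsrc] with w hw hws v
  -- The inverse of the tangent trivialization at `x` is the derivative of the inverse chart, so the
  -- norm bound for the trivialization is the desired one.
  have h1 := TangentBundle.symmL_trivializationAt (I := 𝓘(ℝ, E)) hws
  rw [ModelWithCorners.range_eq_univ, mfderivWithin_univ] at h1
  have h2 := ContinuousLinearMap.le_of_opNorm_le _ hw.le v
  rw [h1] at h2
  have h3 : metricAt g w (tderiv (E := E) (E' := E) (extChartAt 𝓘(ℝ, E) x).symm
          (extChartAt 𝓘(ℝ, E) x w) v)
        (tderiv (E := E) (E' := E) (extChartAt 𝓘(ℝ, E) x).symm (extChartAt 𝓘(ℝ, E) x w) v) =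
      ‖(show TangentSpace 𝓘(ℝ, E) w from
        mfderiv 𝓘(ℝ, E) 𝓘(ℝ, E) (extChartAt 𝓘(ℝ, E) x).symm (extChartAt 𝓘(ℝ, E) x w) v)‖ ^ 2 := by
    rw [← real_inner_self_eq_norm_sq]
    rfl
  rw [h3]
  exact pow_le_pow_left₀ (norm_nonneg _) h2 2

/-- A bounded `1`-form is pointwise bounded by the length of vectors. -/
theorem IsBoundedForm.abs_le {p : N → M} (hp : IsLocalDiffeomorph 𝓘(ℝ, E) 𝓘(ℝ, E) ∞ p)
    {g : RiemannianMetricOn E M} {α : DiffForm E N 1} (hb : IsBoundedForm g p α) :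
    ∃ C ≥ 0, ∀ z u, |formAt α z ![u]| ≤ C * √(metricAt g (p z) (tderiv (E := E) (E' := E) p z u)
      (tderiv (E := E) (E' := E) p z u)) := by
  obtain ⟨C, hC⟩ := hb
  refine ⟨|C|, abs_nonneg C, fun z u => ?_⟩
  by_cases hu : u = 0
  · subst hu
    have h0 : formAt α z ![0] = 0 := (formAt α z).map_coord_zero 0 rfl
    simp [h0]
  · have hDu : tderiv (E := E) (E' := E) p z u ≠ 0 := by
      intro h
      let D : E ≃L[ℝ] E := (hp z).mfderivToContinuousLinearEquiv (by simp)
      have hD : D u = tderiv (E := E) (E' := E) p z u := by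
        have h := (hp z).mfderivToContinuousLinearEquiv_coe (by simp)
        exact congrArg (fun T : E →L[ℝ] E => T u) h
      rw [← hD] at h
      exact hu (by simpa using h)
    set q := metricAt g (p z) (tderiv (E := E) (E' := E) p z u)
      (tderiv (E := E) (E' := E) p z u) with hq
    have hqpos : 0 < q := metricAt_pos g (p z) hDu
    have hr : 0 < √q := Real.sqrt_pos.2 hqpos
    have h1 : |formAt α z ![(√q)⁻¹ • u]| ≤ C := by
      refine hC z ![(√q)⁻¹ • u] fun i => ?_
      have hi : i = 0 := Subsingleton.elim _ _
      subst hi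
      change metricAt g (p z) (tderiv (E := E) (E' := E) p z ((√q)⁻¹ • u))
        (tderiv (E := E) (E' := E) p z ((√q)⁻¹ • u)) = 1
      simp only [map_smul, _root_.smul_apply, smul_eq_mul, ← hq]
      rw [← mul_assoc, ← mul_inv, Real.mul_self_sqrt hqpos.le, inv_mul_cancel₀ hqpos.ne']
    rw [← toLinear_apply, map_smul, smul_eq_mul, toLinear_apply, abs_mul,
      abs_of_pos (inv_pos.2 hr)] at h1
    rw [inv_mul_le_iff₀ hr] at h1
    calc _ ≤ √q * C := h1
      _ ≤ |C| * √q := by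
        rw [mul_comm]
        exact mul_le_mul_of_nonneg_right (le_abs_self C) hr.le

theorem eventually_norm_lt {X F : Type*} [TopologicalSpace X] [SeminormedAddCommGroup F]
    {T : X → F} {y : X} (h : ContinuousAt T y) : ∀ᶠ w in 𝓝 y, ‖T w‖ < ‖T y‖ + 1 :=
  h.norm.eventually_lt_const (lt_add_one _)

variable [FiniteDimensional ℝ E]

/-- In a chart `X = B⁻¹ a`, where `B⁻¹` and the differential of `φ` are continuous on `M` and hence
locally bounded, while the covector is controlled by the induced metric. None of these bounds
depends on the point `z` of the fibre. -/
theorem exists_local_bound_tderiv_liouville {p : N → M}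
    (hp : IsLocalDiffeomorph 𝓘(ℝ, E) 𝓘(ℝ, E) ∞ p)
    {Ω : DiffForm E M 2} (hΩ : IsSymplectic Ω) {α : DiffForm E N 1}
    {g : RiemannianMetricOn E M} (hb : IsBoundedForm g p α) {Y : N → E}
    (hY : IsLiouville p Ω α Y) {φ : M → ℝ} (hφ : ContMDiff 𝓘(ℝ, E) 𝓘(ℝ, ℝ) ∞ φ) (x : M) :
    ∃ C, ∀ᶠ w in 𝓝 x, ∀ z, p z = w → |tderiv (E := E) (E' := ℝ) φ w (Y z)| ≤ C := by
  obtain ⟨C₀, hC₀, hα⟩ := hb.abs_le hp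
  obtain ⟨C₁, hC₁, hg⟩ := exists_metric_bound g x
  set χ := extChartAt 𝓘(ℝ, E) x with hχ
  have hT := extChartAt_target_mem_nhds (I := 𝓘(ℝ, E)) x
  have hTx := mem_extChartAt_target (I := 𝓘(ℝ, E)) x
  have hχc : ContinuousAt χ x := continuousAt_extChartAt x
  have hB : ContinuousAt (fun y => (toBilinear (Ω.inChart x y)).inverse) (χ x) := by
    obtain ⟨e, he⟩ := exists_equiv_of_nondegenerate (nondegenerate_inChart hΩ x hTx)
    have h := contDiffAt_map_inverse (n := 0) e
    rw [he] at h
    exact ContinuousAt.comp (f := fun y => toBilinear (Ω.inChart x y)) h.continuousAt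
      ((contDiffOn_inChart hΩ x).continuousOn.continuousAt hT)
  have hφ' : ContinuousAt (fderiv ℝ (inChartZero φ x)) (χ x) := by
    have h1 : ContDiffAt ℝ ∞ (inChartZero φ x) (χ x) := by
      refine ContDiffAt.congr_of_eventuallyEq ?_ (inChartZero_eventuallyEq hTx)
      exact contMDiffAt_iff_contDiffAt.1
        (hφ.contMDiffAt.comp _ (contMDiffAt_extChartAt_symm x hTx))
    exact (h1.fderiv_right (m := 0) (by norm_cast)).continuousAt
  have hB' : ∀ᶠ w in 𝓝 x, ‖(toBilinear (Ω.inChart x (χ w))).inverse‖ <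
      ‖(toBilinear (Ω.inChart x (χ x))).inverse‖ + 1 :=
    hχc.eventually (eventually_norm_lt (F := (E →L[ℝ] ℝ) →L[ℝ] E) hB)
  have hφ'' : ∀ᶠ w in 𝓝 x, ‖fderiv ℝ (inChartZero φ x) (χ w)‖ <
      ‖fderiv ℝ (inChartZero φ x) (χ x)‖ + 1 :=
    hχc.eventually (eventually_norm_lt (F := E →L[ℝ] ℝ) hφ')
  refine ⟨(‖fderiv ℝ (inChartZero φ x) (χ x)‖ + 1) *
    ((‖(toBilinear (Ω.inChart x (χ x))).inverse‖ + 1) * (C₀ * C₁)), ?_⟩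
  filter_upwards [hg, hB', hφ'', extChartAt_source_mem_nhds (I := 𝓘(ℝ, E)) x] with
    w hgw hBw hφw hws z hz
  have hyT : χ w ∈ χ.target := χ.map_source hws
  have hwy : χ.symm (χ w) = w := χ.left_inv hws
  set X := tderiv (E := E) (E' := E) χ w (Y z) with hX
  have hDX : tderiv (E := E) (E' := E) χ.symm (χ w) X = Y z := by
    have := tderiv_extChartAt_right_inv x hyT (Y z)
    rwa [← hχ, hwy] at this
  have hφX : tderiv (E := E) (E' := ℝ) φ w (Y z) = fderiv ℝ (inChartZero φ x) (χ w) X := by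
    have := fderiv_inChartZero hφ hyT (Y z)
    rw [← hχ, hwy] at this
    exact this.symm
  let D : E ≃L[ℝ] E := (hp z).mfderivToContinuousLinearEquiv (by simp)
  have hD : ∀ u, tderiv (E := E) (E' := E) p z u = D u := fun u => by
    have h := (hp z).mfderivToContinuousLinearEquiv_coe (by simp)
    exact congrArg (fun T : E →L[ℝ] E => T u) h.symm
  -- This covector is `α z` transported to the chart by the inverse of the derivative of `p`; the
  -- induced length of the lifted vector is the length of `v'` in `g`.
  have hBX : ‖toBilinear (Ω.inChart x (χ w)) X‖ ≤ C₀ * C₁ := by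
    refine ContinuousLinearMap.opNorm_le_bound _ (by positivity) fun v => ?_
    set v' := tderiv (E := E) (E' := E) χ.symm (χ w) v with hv'
    have e1 : toBilinear (Ω.inChart x (χ w)) X v = formAt α z ![D.symm v'] := by
      rw [← hY z, hD, D.apply_symm_apply, inChart_eq, toBilinear_comp,
        ContinuousLinearMap.bilinearComp_apply, ← hχ, hDX, hwy, toBilinear_apply, hz]
    rw [e1, Real.norm_eq_abs]
    refine (hα z _).trans ?_
    rw [hD, D.apply_symm_apply, hz, mul_assoc]
    refine mul_le_mul_of_nonneg_left ?_ hC₀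
    rw [← Real.sqrt_sq (by positivity : 0 ≤ C₁ * ‖v‖)]
    exact Real.sqrt_le_sqrt (hgw v)
  have hXn : ‖X‖ ≤ (‖(toBilinear (Ω.inChart x (χ x))).inverse‖ + 1) * (C₀ * C₁) := by
    obtain ⟨e, he⟩ := exists_equiv_of_nondegenerate (nondegenerate_inChart hΩ x hyT)
    have e1 : X = (toBilinear (Ω.inChart x (χ w))).inverse
        (toBilinear (Ω.inChart x (χ w)) X) := by
      rw [← he, ContinuousLinearMap.inverse_equiv]
      simp
    calc ‖X‖ = _ := congrArg norm e1
      _ ≤ ‖(toBilinear (Ω.inChart x (χ w))).inverse‖ * ‖toBilinear (Ω.inChart x (χ w)) X‖ :=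
        ContinuousLinearMap.le_opNorm _ _
      _ ≤ _ := mul_le_mul hBw.le hBX (norm_nonneg _) (by positivity)
  rw [hφX, ← Real.norm_eq_abs]
  exact (ContinuousLinearMap.le_opNorm _ _).trans
    (mul_le_mul hφw.le hXn (norm_nonneg _) (by positivity))

/-- The derivative of a function along the Liouville vector field of a bounded primitive is
bounded. -/
theorem exists_bound_tderiv_liouville [CompactSpace M] {p : N → M}
    (hp : IsLocalDiffeomorph 𝓘(ℝ, E) 𝓘(ℝ, E) ∞ p)
    {Ω : DiffForm E M 2} (hΩ : IsSymplectic Ω) {α : DiffForm E N 1}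
    {g : RiemannianMetricOn E M} (hb : IsBoundedForm g p α) {Y : N → E}
    (hY : IsLiouville p Ω α Y) {φ : M → ℝ} (hφ : ContMDiff 𝓘(ℝ, E) 𝓘(ℝ, ℝ) ∞ φ) :
    ∃ C, ∀ w z, p z = w → |tderiv (E := E) (E' := ℝ) φ w (Y z)| ≤ C := by
  choose C hC using exists_local_bound_tderiv_liouville hp hΩ hb hY hφ
  obtain ⟨t, ht⟩ := CompactSpace.elim_nhds_subcover _ hC
  refine ⟨∑ x ∈ t, |C x|, fun w z hz => ?_⟩
  have hw : w ∈ (⊤ : Set M) := trivial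
  rw [← ht] at hw
  simp only [Set.mem_iUnion] at hw
  obtain ⟨x, hx, hwx⟩ := hw
  exact ((hwx z hz).trans (le_abs_self _)).trans
    (Finset.single_le_sum (f := fun x => |C x|) (fun _ _ => abs_nonneg _) hx)

end Bound

/-! ### Averaging over the group, partitions of unity and adapted covers. -/

/-- Double counting: an invariant mean agrees on `F i j` and `F' i j`, so the sum of its values over
all pairs, taken by rows, is `∑ c i` and, taken by columns, is zero. -/
theorem not_isAmenable_of_sum_ne_zero {G : Type*} [Group G] {ι : Type*} [Fintype ι]
    (F F' : ι → ι → G → ℝ) (c : ι → ℝ) (hF' : ∀ i j, ∃ C, ∀ g, |F' i j g| ≤ C)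
    (hrow : ∀ i g, ∑ j, F i j g = c i) (htrans : ∀ i j, ∃ a, ∀ g, F i j g = F' i j (a * g))
    (hcol : ∀ j g, ∑ i, F' i j g = 0) (hc : ∑ i, c i ≠ 0) : ¬ IsAmenable G := by
  rintro ⟨m, -, hone, hinv⟩
  have hF : ∀ i j, ∃ C, ∀ g, |F i j g| ≤ C := fun i j => by
    obtain ⟨a, ha⟩ := htrans i j
    obtain ⟨C, hC⟩ := hF' i j
    exact ⟨C, fun g => by rw [ha]; exact hC _⟩
  let f : ι → ι → boundedFunctions G := fun i j => ⟨F i j, hF i j⟩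
  let f' : ι → ι → boundedFunctions G := fun i j => ⟨F' i j, hF' i j⟩
  let e : boundedFunctions G := ⟨fun _ => 1, 1, fun _ => by simp⟩
  have hm : ∀ i j, m (f i j) = m (f' i j) := fun i j => by
    obtain ⟨a, ha⟩ := htrans i j
    exact hinv a (f' i j) (f i j) ha
  have h1 : ∀ i, ∑ j, f i j = c i • e := fun i => by
    refine Subtype.ext (funext fun g => ?_)
    simpa [f, e, Finset.sum_apply] using hrow i g
  have h2 : ∀ j, ∑ i, f' i j = 0 := fun j => by
    refine Subtype.ext (funext fun g => ?_)
    simpa [f', Finset.sum_apply] using hcol j g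
  refine hc ?_
  calc ∑ i, c i = ∑ i, ∑ j, m (f i j) := by
        refine Finset.sum_congr rfl fun i _ => ?_
        rw [← map_sum, h1, map_smul, hone e fun _ => rfl, smul_eq_mul, mul_one]
    _ = ∑ j, ∑ i, m (f' i j) := by
        rw [Finset.sum_comm]
        exact Finset.sum_congr rfl fun j _ => Finset.sum_congr rfl fun i _ => hm i j
    _ = 0 := Finset.sum_eq_zero fun j _ => by rw [← map_sum, h2, map_zero]

theorem sum_tderiv_eq_zero {E : Type*} [NormedAddCommGroup E] [NormedSpace ℝ E] {M : Type*}
    [TopologicalSpace M] [ChartedSpace E M] {ι : Type*} [Fintype ι] (φ : ι → M → ℝ)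
    (hφ : ∀ i, ContMDiff 𝓘(ℝ, E) 𝓘(ℝ, ℝ) ∞ (φ i)) (h1 : ∀ x, ∑ i, φ i x = 1) (x : M) :
    ∑ i, tderiv (E := E) (E' := ℝ) (φ i) x = 0 := by
  classical
  have key : ∀ t : Finset ι, ∃ L : E →L[ℝ] ℝ, L = ∑ i ∈ t, tderiv (E := E) (E' := ℝ) (φ i) x ∧
      HasMFDerivAt 𝓘(ℝ, E) 𝓘(ℝ, ℝ) (∑ i ∈ t, φ i) x L := fun t => by
    induction t using Finset.induction_on with
    | empty => exact ⟨0, rfl, hasMFDerivAt_const (0 : ℝ) x⟩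
    | insert i t hi ih =>
      obtain ⟨L, hL, h⟩ := ih
      refine ⟨tderiv (E := E) (E' := ℝ) (φ i) x + L, by rw [Finset.sum_insert hi, hL], ?_⟩
      rw [Finset.sum_insert hi]
      exact HasMFDerivAt.add ((hφ i).mdifferentiable (by simp) x).hasMFDerivAt h
  obtain ⟨L, hL, h⟩ := key Finset.univ
  have hsum : ∑ i, φ i = fun _ => 1 := by
    funext y
    rw [Finset.sum_apply, h1]
  rw [hsum] at h
  exact hL.symm.trans (h.mfderiv.symm.trans mfderiv_const)

/-- A compact manifold has a cover by small path connected open sets such that a covering map has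
sections over the union of any two of them that meet. -/
theorem exists_adapted_cover {E : Type*} [NormedAddCommGroup E] [NormedSpace ℝ E]
    [FiniteDimensional ℝ E] {M : Type*} [TopologicalSpace M] [ChartedSpace E M]
    [T2Space M] [CompactSpace M] {N : Type*} [TopologicalSpace N] {p : N → M}
    (cov : IsCoveringMap p) :
    ∃ U : M → Set M, (∀ x, IsOpen (U x) ∧ x ∈ U x ∧ IsPathConnected (U x) ∧
        U x ⊆ (extChartAt 𝓘(ℝ, E) x).source) ∧
      ∀ x x', (U x ∩ U x').Nonempty → ∃ W, U x ∪ U x' ⊆ W ∧ HasSectionsOn p W := by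
  have := ChartedSpace.secondCountable_of_sigmaCompact E M
  have := ChartedSpace.locallyPathConnectedSpace E M
  let _ := TopologicalSpace.metrizableSpaceMetric M
  choose W hWo hxW hWs using exists_hasSectionsOn cov
  -- With a Lebesgue number `δ` and sets inside balls of radius `δ / 4`, two sets that meet lie in
  -- the ball of radius `δ` about a common point. Passing to path components afterwards gives path
  -- connectedness.
  obtain ⟨δ, hδ, hball⟩ := lebesgue_number_lemma_of_metric (isCompact_univ (X := M)) hWo
    (fun x _ => Set.mem_iUnion.2 ⟨x, hxW x⟩)
  have hO : ∀ x : M, IsOpen (Metric.ball x (δ / 4) ∩ (extChartAt 𝓘(ℝ, E) x).source) := fun x =>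
    Metric.isOpen_ball.inter (isOpen_extChartAt_source x)
  have hxO : ∀ x : M, x ∈ Metric.ball x (δ / 4) ∩ (extChartAt 𝓘(ℝ, E) x).source := fun x =>
    ⟨Metric.mem_ball_self (by positivity), mem_extChartAt_source x⟩
  have hsub : ∀ x : M, pathComponentIn
      (Metric.ball x (δ / 4) ∩ (extChartAt 𝓘(ℝ, E) x).source) x ⊆
      Metric.ball x (δ / 4) ∩ (extChartAt 𝓘(ℝ, E) x).source := fun x => pathComponentIn_subset
  refine ⟨fun x => pathComponentIn (Metric.ball x (δ / 4) ∩ (extChartAt 𝓘(ℝ, E) x).source) x,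
    fun x => ⟨(hO x).pathComponentIn x, mem_pathComponentIn_self (hxO x),
      isPathConnected_pathComponentIn (hxO x), (hsub x).trans Set.inter_subset_right⟩, ?_⟩
  rintro x x' ⟨y, hy, hy'⟩
  obtain ⟨i, hi⟩ := hball y trivial
  refine ⟨W i, Set.union_subset (fun w hw => hi ?_) (fun w hw => hi ?_), hWs i⟩
  · have h1 := Metric.mem_ball.1 (hsub x hy).1
    have h2 := Metric.mem_ball.1 (hsub x hw).1
    rw [Metric.mem_ball]
    linarith [dist_triangle_right w y x]
  · have h1 := Metric.mem_ball.1 (hsub x' hy').1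
    have h2 := Metric.mem_ball.1 (hsub x' hw).1
    rw [Metric.mem_ball]
    linarith [dist_triangle_right w y x']

end SymplecticHyperbolic

end

/-! ### The main theorem. -/

theorem theoremT
    {E : Type*} [NormedAddCommGroup E] [NormedSpace ℝ E] [FiniteDimensional ℝ E]
    (hE : 0 < Module.finrank ℝ E)
    {M : Type*} [TopologicalSpace M] [ChartedSpace E M] [IsManifold 𝓘(ℝ, E) ∞ M]
    [T2Space M] [CompactSpace M] [ConnectedSpace M]
    {N : Type*} [TopologicalSpace N] [ChartedSpace E N] [IsManifold 𝓘(ℝ, E) ∞ N]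
    (p : N → M) (hp : SymplecticHyperbolic.IsUniversalCovering E p)
    (Ω : SymplecticHyperbolic.DiffForm E M 2)
    (hΩ : SymplecticHyperbolic.IsSymplecticallyHyperbolic p Ω)
    (x₀ : M) :
    ¬ SymplecticHyperbolic.IsAmenable (FundamentalGroup M x₀) := by
  open SymplecticHyperbolic in
  classical
  obtain ⟨hsymp, g, α, hα, hd, hb⟩ := hΩ
  have hloc := hp.isLocalDiffeomorph
  let _ : MeasurableSpace E := borel E
  have : BorelSpace E := ⟨rfl⟩
  let μ : MeasureTheory.Measure E := MeasureTheory.Measure.addHaar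
  have := ChartedSpace.locallyPathConnectedSpace E M
  have : PathConnectedSpace M := pathConnectedSpace_iff_connectedSpace.2 inferInstance
  obtain ⟨U, hU, hUW⟩ := exists_adapted_cover (E := E) hp.isCoveringMap
  obtain ⟨t, ht⟩ := CompactSpace.elim_nhds_subcover U fun x => (hU x).1.mem_nhds (hU x).2.1
  obtain ⟨φ, hφU⟩ := SmoothPartitionOfUnity.exists_isSubordinate 𝓘(ℝ, E)
    (isClosed_univ (X := M)) (fun i : t => U i) (fun i => (hU i).1) (by
      intro x _
      have hx : x ∈ (⊤ : Set M) := trivial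
      rw [← ht] at hx
      simp only [Set.mem_iUnion] at hx ⊢
      obtain ⟨i, hi, hxi⟩ := hx
      exact ⟨⟨i, hi⟩, hxi⟩)
  have hφs : ∀ i, ContMDiff 𝓘(ℝ, E) 𝓘(ℝ, ℝ) ∞ (φ i) := fun i => (φ i).contMDiff
  have hφ1 : ∀ x, ∑ i, φ i x = 1 := fun x => by
    rw [← finsum_eq_sum_of_fintype]
    exact φ.sum_eq_one (Set.mem_univ x)
  have hchart : ∀ i : t, U i ⊆ (extChartAt 𝓘(ℝ, E) (i : M)).source := fun i => (hU i).2.2.2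
  have hφc : ∀ i : t, tsupport (φ i) ⊆ (extChartAt 𝓘(ℝ, E) (i : M)).source := fun i =>
    (hφU i).trans (hchart i)
  obtain ⟨s, hs, hps, hst⟩ := exists_equivariant_sections hp.isCoveringMap hp.surjective x₀
    (fun i : t => U i) (fun i => (hU i).2.2.1) fun i j => hUW i j
  obtain ⟨Y, hY⟩ := exists_isLiouville hloc hsymp α
  have hdsum : ∀ x, ∑ i, tderiv (E := E) (E' := ℝ) (φ i) x = 0 := fun x =>
    sum_tderiv_eq_zero (fun i => φ i) hφs hφ1 x
  -- The two families differ in the section along which `Y` is evaluated and in the chart used for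
  -- integration: those of `i` for the rows, those of `j` for the columns.
  refine not_isAmenable_of_sum_ne_zero
    (fun (i j : t) g => chartIntegral μ Ω (i : M)
      (fun x => φ j x * tderiv (E := E) (E' := ℝ) (φ i) x (Y (s i g x))))
    (fun (i j : t) g => chartIntegral μ Ω (j : M)
      (fun x => φ j x * tderiv (E := E) (E' := ℝ) (φ i) x (Y (s j g x))))
    (fun i : t => -(Module.finrank ℝ E / 2 * chartIntegral μ Ω (i : M) (φ i))) ?_ ?_ ?_ ?_ ?_
  · intro i j
    obtain ⟨C, hC⟩ := exists_bound_tderiv_liouville hloc hsymp hb hY (hφs i)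
    obtain ⟨D, hD⟩ := exists_chartIntegral_bound μ hsymp (hφc j) C
    refine ⟨D, fun g => hD _ (fun z => ?_) fun z hz => ?_⟩
    · rw [abs_mul, abs_of_nonneg (φ.nonneg j z)]
      have h1 := hC z (s j g z) (hps j g z)
      calc _ ≤ 1 * |tderiv (E := E) (E' := ℝ) (φ i) z (Y (s j g z))| :=
            mul_le_mul_of_nonneg_right (φ.le_one j z) (abs_nonneg _)
        _ ≤ C := by rwa [one_mul]
    · rw [image_eq_zero_of_notMem_tsupport hz, zero_mul]
  · intro i g
    -- Summing over `j` removes the factor `φ j`, so the divergence formula on `U i` evaluates the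
    -- row.
    rw [← chartIntegral_tderiv_liouville μ hloc hsymp hα hd hY (hs i g) (hU i).1 (hchart i)
      (hφs i) (hφU i)]
    simp only [chartIntegral]
    rw [← MeasureTheory.integral_finsetSum _ fun j _ =>
      integrableOn_tderiv_liouville μ hloc hsymp hα hd hY (hs i g) (hU i).1 (hchart i) (hφs i)
        (φ j).contMDiff.continuous (θ := φ i) (hφU i) fun z hz => by
          rw [tderiv_eq_zero_of_notMem_tsupport hz, smul_zero]]
    simp only [← Finset.sum_mul, hφ1, one_mul]
  · intro i j
    have key : ∃ a, ∀ g, ∀ x ∈ U i ∩ U j, s i g x = s j (a * g) x := by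
      by_cases hij : (U i ∩ U j).Nonempty
      · exact hst i j hij
      · exact ⟨1, fun g x hx => absurd ⟨x, hx⟩ hij⟩
    obtain ⟨a, ha⟩ := key
    refine ⟨a, fun g => ?_⟩
    -- The integrand lives where both supports meet; this allows the exchange of the sections there
    -- and then the passage from the chart at `i` to the chart at `j`.
    have hzero : ∀ x, x ∉ tsupport (φ i) ∩ tsupport (φ j) → ∀ v,
        φ j x * tderiv (E := E) (E' := ℝ) (φ i) x v = 0 := by
      intro x hx v
      by_cases hxi : x ∈ tsupport (φ i)
      · rw [image_eq_zero_of_notMem_tsupport fun hxj => hx ⟨hxi, hxj⟩, zero_mul]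
      · rw [tderiv_eq_zero_of_notMem_tsupport hxi]
        simp
    have hfun : (fun x => φ j x * tderiv (E := E) (E' := ℝ) (φ i) x (Y (s i g x))) =
        fun x => φ j x * tderiv (E := E) (E' := ℝ) (φ i) x (Y (s j (a * g) x)) := by
      funext x
      by_cases hx : x ∈ tsupport (φ i) ∩ tsupport (φ j)
      · rw [ha g x ⟨hφU i hx.1, hφU j hx.2⟩]
      · rw [hzero x hx, hzero x hx]
    rw [hfun]
    refine chartIntegral_eq μ Ω _ _ _ fun z hz => ?_
    by_contra hcon
    refine hz (hzero z (fun h => hcon ⟨hφc i h.1, hφc j h.2⟩) _)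
  · intro j g
    simp only [chartIntegral]
    -- In a column the section does not depend on `i`, so the sum falls on the differentials of the
    -- partition of unity and vanishes pointwise.
    rw [← MeasureTheory.integral_finsetSum _ fun i _ =>
      integrableOn_tderiv_liouville μ hloc hsymp hα hd hY (hs j g) (hU j).1 (hchart j) (hφs i)
        (φ j).contMDiff.continuous (θ := φ j) (hφU j) fun z hz => by
          rw [image_eq_zero_of_notMem_tsupport hz, zero_smul]]
    simp only [← Finset.sum_mul, ← Finset.mul_sum, ← _root_.sum_apply, hdsum, _root_.zero_apply,
      mul_zero, zero_mul, MeasureTheory.integral_zero]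
  · obtain ⟨i, -, hi⟩ := Finset.exists_ne_zero_of_sum_ne_zero
      (s := Finset.univ) (f := fun i => φ i x₀) (by rw [hφ1]; exact one_ne_zero)
    have hpos : 0 < ∑ i : t, chartIntegral μ Ω (i : M) (φ i) :=
      Finset.sum_pos' (fun i _ => chartIntegral_nonneg μ Ω _ (φ.nonneg i))
        ⟨i, Finset.mem_univ i, chartIntegral_pos μ hsymp (φ i).contMDiff.continuous
          (φ.nonneg i) (hφc i) hi⟩
    rw [Finset.sum_neg_distrib, ← Finset.mul_sum]
    have hE' : (0 : ℝ) < Module.finrank ℝ E := by exact_mod_cast hE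
    exact neg_ne_zero.2 (mul_pos (by positivity) hpos).ne'
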